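/- **Setting.** Let $F=\mathbb{Q}(\sqrt{-3})\subset\mathbb{C}$ and let $f\in F[x]$ be a post-critically finite cubic with critical points $\gamma_1,\gamma_2\in\mathbb{C}$, whose critical orbits do not collide ($f^k(\gamma_1)\ne f^k(\gamma_2)$ for all $k\ge1$), and whose combined critical orbit $\{\{f^k(\gamma_1),f^k(\gamma_2)\}:k\ge 1\}$ has exactly one element. Let $t\in F$. **Markov process.** A type sequence is a finite sequence of parts $[c,k]$ with a label $c\in\{s,n\}$ and a size $k\ge1$. In one step the parts evolve independently. A part $[s,k]$ becomes $[s,3k]$ with probability $2/3$, $[s,k]^3$ with probability $1/12$, and $[s,k][n,k]^2$ with probability $1/4$; a part $[n,k]$ becomes $[n,2k][s,k]$ or $[s,2k][n,k]$, each with probability $1/2$. The level $n$ data with given initial data is the distribution obtained by applying $n-1$ steps to the initial data. **Groups.** Let $T_n$ be the ternary rooted tree truncated at level $n$; its level-$n$ vertices are the words of length $n$ over $\{0,1,2\}$, ordered lexicographically. $\mathrm{Aut}(T_n)$ acts faithfully on level $n$, and $\mathrm{Aut}(T_{n-1})$ is embedded in $\mathrm{Aut}(T_n)$ by $\sigma\mapsto(\sigma,\mathrm{id},\mathrm{id})$,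 acting on the subtree below the vertex $0$. Given $\sigma\in\mathrm{Aut}(T_n)$ with a label on each of its cycles on level $n$ (fixed points included), its iterate is the automorphism of $T_{n+1}$ sending $w*j$ to $\sigma(w)*\pi_w(j)$. Here every cycle is written starting from its smallest vertex; if $w$ is the last vertex of a cycle, then $\pi_w=(0,1,2)$ when the cycle has label $s$ and $\pi_w=(0,1)$ when it has label $n$; otherwise $\pi_w=\mathrm{id}$. A cycle of length $k$ with label $s$ thus yields one cycle of length $3k$, labelled $s$; a cycle of length $k$ with label $n$ yields one of length $2k$, labelled $n$, and one of length $k$, labelled $s$. Let $x_1=(0,1,2)$ with label $s$; $y_1=(0,1)(2)$ with labels $n,s$; $z_1=(0)(1)(2)$ with labels $n,n,s$; and let $x_n,y_n,z_n\in\mathrm{Aut}(T_n)$ be their $(n-1)$-st iterates. Put $L_0=1$ and, for $n\ge1$, $L_n=\langle x_n,z_n,L_{n-1}\rangle$ and $M_n=\langle x_n,y_n,z_n,L_{n-1}\rangle$. Let $H_n$ be the normal closure of $L_{n-1}$ in $L_n$, and $K_n$ the normal closure of $\langle H_n,z_n\rangle$ in $L_n$. **Theorem.** Define initial data and subgroups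 $G_n\le\mathrm{Aut}(T_n)$, $n\geq 1$, as follows. 1. If $f-t$ is reducible over $F$ and $(f(\gamma_1)-t)(f(\gamma_2)-t)$ is a square in $F$: initial data $[[s,1]^3,\frac14],\ [[s,1][n,1]^2,\frac34]$ and $G_n=K_n$. 2. If $f-t$ is irreducible and $(f(\gamma_1)-t)(f(\gamma_2)-t)$ is a square: initial data $[[s,3],\frac23],\ [[s,1]^3,\frac1{12}],\ [[s,1][n,1]^2,\frac14]$ and $G_n=L_n$. 3. If $f-t$ is reducible and $(f(\gamma_1)-t)(f(\gamma_2)-t)$ is not a square: initial data $[[s,1]^3,\frac18],\ [[s,1][n,1]^2,\frac38],\ [[n,2][s,1],\frac14],\ [[s,2][n,1],\frac14]$ and $G_n=\langle K_n,y_n\rangle$. 4. If $f-t$ is irreducible and $(f(\gamma_1)-t)(f(\gamma_2)-t)$ is not a square: initial data $[[s,3],\frac13],\ [[s,1]^3,\frac1{24}],\ [[s,1][n,1]^2,\frac18],\ [[n,2][s,1],\frac14],\ [[s,2][n,1],\frac14]$ and $G_n=M_n$. Then in each case the groups $G_n$ realize the Markov process: for every $n\ge1$ and every multiset $c$ of positive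 integers, the proportion of elements of $G_n$ whose multiset of cycle lengths on level $n$ (fixed points included) equals $c$ is the probability that the level $n$ data has multiset of sizes $c$. -/

import Mathlib

open Polynomial Equiv
open scoped ENNReal NNReal

noncomputable section

namespace CubicMarkov

/-! ## Cubic polynomials and their critical orbits -/

/-- The field `ℚ(√-3)`, as a subfield of `ℂ`. -/
abbrev QSqrtNegThree : IntermediateField ℚ ℂ :=
  IntermediateField.adjoin ℚ {((Real.sqrt 3 : ℝ) : ℂ) * Complex.I}

/-- The `k`-th iterate of the self-map `z ↦ f z` of `ℂ`. -/
def iter (f : QSqrtNegThree[X]) (k : ℕ) : ℂ → ℂ := (fun z => aeval z f)^[k]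

/-- The combined critical orbit: the set of all `{f^k(γ₁), f^k(γ₂)}` with `k ≥ 1`. -/
def combinedCriticalOrbit (f : QSqrtNegThree[X]) (γ₁ γ₂ : ℂ) : Set (Set ℂ) :=
  {S | ∃ k : ℕ, 1 ≤ k ∧ S = {iter f k γ₁, iter f k γ₂}}

/-- `f` is a post-critically finite cubic with critical points `γ₁, γ₂` (the roots of the
derivative, with multiplicity). -/
structure IsPCFCubic (f : QSqrtNegThree[X]) (γ₁ γ₂ : ℂ) : Prop where
  natDegree_eq : f.natDegree = 3
  critical : f.derivative.aroots ℂ = {γ₁, γ₂}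
  finite_fst : {z | ∃ k : ℕ, 1 ≤ k ∧ z = iter f k γ₁}.Finite
  finite_snd : {z | ∃ k : ℕ, 1 ≤ k ∧ z = iter f k γ₂}.Finite

/-- The critical orbits do not collide: `f^k(γ₁) ≠ f^k(γ₂)` for all `k ≥ 1`. -/
def CriticalOrbitsDoNotCollide (f : QSqrtNegThree[X]) (γ₁ γ₂ : ℂ) : Prop :=
  ∀ k : ℕ, 1 ≤ k → iter f k γ₁ ≠ iter f k γ₂

/-- `(f(γ₁) - t)(f(γ₂) - t)`, that is `g(f(γ₁)) g(f(γ₂))` for `g = x - t`, is a square in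
`ℚ(√-3)`: the label of `x - t` is `s`. -/
def CriticalProductIsSquare (f : QSqrtNegThree[X]) (γ₁ γ₂ : ℂ) (t : QSqrtNegThree) : Prop :=
  ∃ r : QSqrtNegThree, (r : ℂ) ^ 2 = (iter f 1 γ₁ - t) * (iter f 1 γ₂ - t)

/-! ## The Markov process -/

/-- Labels for combined critical orbit of length one: a single letter, `s` (square) or `n`
(non-square), written multiplicatively as the class `1` or `-1`. Since the combined critical orbit
has only one element, the action of `f` on labels is trivial. -/
abbrev Label : Type := ℤˣ

/-- The label `s`. -/
abbrev sq : Label := 1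

/-- The label `n`. -/
abbrev nsq : Label := -1

/-- A type sequence: a list of typed parts `[label, size]`. -/
abbrev TypeSeq : Type := List (Label × ℕ)

/-- Uniform distribution on the ordered pairs of labels with product `c`. -/
def uniformPairs (c : Label) : PMF (Label × Label) :=
  PMF.uniformOfFinset (Finset.univ.filter fun d : Label × Label => d.1 * d.2 = c)
    ⟨(c, 1), by simp⟩

/-- Uniform distribution on the ordered triples of labels with product `c`. -/
def uniformTriples (c : Label) : PMF (Label × Label × Label) :=
  PMF.uniformOfFinset (Finset.univ.filter fun d : Label × Label × Label => d.1 * d.2.1 * d.2.2 = c)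
    ⟨(c, 1, 1), by simp⟩

/-- The distribution on `Bool` giving probability `2/3` to `true` and `1/3` to `false`. -/
def twoThirds : PMF Bool :=
  PMF.ofFintype (fun b => ((if b then 2 / 3 else 1 / 3 : ℝ≥0) : ℝ≥0∞)) (by
    rw [← ENNReal.ofNNReal_finsetSum, ENNReal.coe_eq_one, ← NNReal.coe_inj]
    simp; norm_num)

/-- Transition of one typed part. A part `[s, k]` becomes `[s, 3k]` with probability `2/3`, and with
probability `1/3` it becomes three parts of size `k`, whose labels form a uniform ordered
triple with product `s`. A part `[n, k]` becomes two parts, of sizes `2k` and `k`, whose labels form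
a uniform ordered pair with product `n`. -/
def stepPart (p : Label × ℕ) : PMF TypeSeq :=
  if p.1 = sq then
    twoThirds.bind fun remains =>
      if remains then PMF.pure [(p.1, 3 * p.2)]
      else (uniformTriples p.1).map fun d => [(d.1, p.2), (d.2.1, p.2), (d.2.2, p.2)]
  else (uniformPairs p.1).map fun d => [(d.1, 2 * p.2), (d.2, p.2)]

/-- Transition of a type sequence: its parts evolve independently. -/
def stepSeq : TypeSeq → PMF TypeSeq
  | [] => PMF.pure []
  | p :: l => (stepPart p).bind fun a => (stepSeq l).map fun b => a ++ b

/-- The distribution obtained from the data `init` by applying the Markov process `n` times. -/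
def markov (init : PMF TypeSeq) : ℕ → PMF TypeSeq
  | 0 => init
  | n + 1 => (markov init n).bind stepSeq

/-- The partition underlying a type sequence. -/
def sizes (l : TypeSeq) : Multiset ℕ := (l.map Prod.snd : Multiset ℕ)

/-- `[[s,1]^3, 1/4], [[s,1][n,1]^2, 3/4]`. -/
def model₁ : PMF TypeSeq :=
  (PMF.ofFintype (fun i : Fin 2 => ((![1 / 4, 3 / 4] i : ℝ≥0) : ℝ≥0∞)) (by
    rw [← ENNReal.ofNNReal_finsetSum, ENNReal.coe_eq_one, ← NNReal.coe_inj]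
    simp [Fin.sum_univ_succ]; norm_num)).map
    ![[(sq, 1), (sq, 1), (sq, 1)], [(sq, 1), (nsq, 1), (nsq, 1)]]

/-- `[[s,3], 2/3], [[s,1]^3, 1/12], [[s,1][n,1]^2, 1/4]`. -/
def model₂ : PMF TypeSeq :=
  (PMF.ofFintype (fun i : Fin 3 => ((![2 / 3, 1 / 12, 1 / 4] i : ℝ≥0) : ℝ≥0∞)) (by
    rw [← ENNReal.ofNNReal_finsetSum, ENNReal.coe_eq_one, ← NNReal.coe_inj]
    simp [Fin.sum_univ_succ]; norm_num)).map
    ![[(sq, 3)], [(sq, 1), (sq, 1), (sq, 1)], [(sq, 1), (nsq, 1), (nsq, 1)]]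

/-- `[[s,1]^3, 1/8], [[s,1][n,1]^2, 3/8], [[n,2][s,1], 1/4], [[s,2][n,1], 1/4]`. -/
def model₃ : PMF TypeSeq :=
  (PMF.ofFintype (fun i : Fin 4 => ((![1 / 8, 3 / 8, 1 / 4, 1 / 4] i : ℝ≥0) : ℝ≥0∞)) (by
    rw [← ENNReal.ofNNReal_finsetSum, ENNReal.coe_eq_one, ← NNReal.coe_inj]
    simp [Fin.sum_univ_succ]; norm_num)).map
    ![[(sq, 1), (sq, 1), (sq, 1)], [(sq, 1), (nsq, 1), (nsq, 1)],
      [(nsq, 2), (sq, 1)], [(sq, 2), (nsq, 1)]]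

/-- `[[s,3], 1/3], [[s,1]^3, 1/24], [[s,1][n,1]^2, 1/8], [[n,2][s,1], 1/4], [[s,2][n,1], 1/4]`. -/
def model₄ : PMF TypeSeq :=
  (PMF.ofFintype (fun i : Fin 5 => ((![1 / 3, 1 / 24, 1 / 8, 1 / 4, 1 / 4] i : ℝ≥0) : ℝ≥0∞)) (by
    rw [← ENNReal.ofNNReal_finsetSum, ENNReal.coe_eq_one, ← NNReal.coe_inj]
    simp [Fin.sum_univ_succ]; norm_num)).map
    ![[(sq, 3)], [(sq, 1), (sq, 1), (sq, 1)], [(sq, 1), (nsq, 1), (nsq, 1)],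
      [(nsq, 2), (sq, 1)], [(sq, 2), (nsq, 1)]]

/-! ## Automorphisms of the ternary rooted tree -/

/-- The vertices of level `n`: words of length `n` in the alphabet `{0, 1, 2}`, first letter (the
one nearest to the root) first. -/
abbrev Word (n : ℕ) : Type := Fin n → Fin 3

/-- The automorphism group of the tree truncated at level `n`, as a group of permutations of level
`n`: the permutations which respect the relation of having the same prefix of length `k`, for
every `k`. -/
def treeAut (n : ℕ) : Subgroup (Perm (Word n)) where
  carrier := {σ | ∀ (k : ℕ) (v w : Word n),
    (∀ i : Fin n, (i : ℕ) < k → σ v i = σ w i) ↔ (∀ i : Fin n, (i : ℕ) < k → v i = w i)}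
  one_mem' := fun _ _ _ => Iff.rfl
  mul_mem' := fun {σ τ} hσ hτ k v w => (hσ k (τ v) (τ w)).trans (hτ k v w)
  inv_mem' := fun {σ} hσ k v w => by
    have := hσ k (σ⁻¹ v) (σ⁻¹ w)
    have e : ∀ u, σ (σ⁻¹ u) = u := fun u => σ.apply_symm_apply u
    rw [e, e] at this
    exact this.symm

/-- The extension of `σ` to level `n + 1` by a family `s` of permutations of `{0, 1, 2}` indexed by
the vertices of level `n`: the vertex `w * j` is sent to `(σ w) * (s_w j)`. -/
def extend {n : ℕ} (s : Word n → Perm (Fin 3)) (σ : Perm (Word n)) : Perm (Word (n + 1)) where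
  toFun v := Fin.snoc (α := fun _ => Fin 3) (σ (Fin.init v)) (s (Fin.init v) (v (Fin.last n)))
  invFun v := Fin.snoc (α := fun _ => Fin 3) (σ⁻¹ (Fin.init v))
    ((s (σ⁻¹ (Fin.init v)))⁻¹ (v (Fin.last n)))
  left_inv v := by simp
  right_inv v := by simp

/-- `w` is the last entry of its cycle in `σ`, when every cycle is written starting from its
smallest vertex (the vertices of a level being ordered from left to right, i.e.
lexicographically). -/
def IsLastInCycle {n : ℕ} (σ : Perm (Word n)) (w : Word n) : Prop :=
  ∀ k : ℕ, toLex (σ w) ≤ toLex ((σ ^ k) w)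

/-- A permutation of level `n` with a label attached to each of its cycles (recorded at each vertex
of the cycle). -/
abbrev TypedPerm (n : ℕ) : Type := Perm (Word n) × (Word n → Label)

open Classical in
/-- Iteration of a typed permutation: each cycle with label `s` is tripled, and the new cycle
has label `s`; each cycle with label `n` is doubled, producing a cycle of twice the length with
label `n` (over the letters `0, 1`) and a cycle of the same length with label `s` (over the
letter `2`). -/
def iterate {n : ℕ} (g : TypedPerm n) : TypedPerm (n + 1) :=
  (extend (fun w => if IsLastInCycle g.1 w then
      (if g.2 w = sq then finRotate 3 else swap 0 1) else 1) g.1,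
    fun v => if g.2 (Fin.init v) = sq then sq else if v (Fin.last n) = 2 then sq else nsq)

/-- The permutation of level `1` given by a permutation of `{0, 1, 2}`. -/
def levelOne (π : Perm (Fin 3)) : Perm (Word 1) := extend (fun _ => π) (1 : Perm (Word 0))

/-- `xGen n` is the typed permutation `x_{n+1}` of level `n + 1`: the `n`-th iterate of `(0,1,2)`
with type `[s,3]`. -/
def xGen : (n : ℕ) → TypedPerm (n + 1)
  | 0 => (levelOne (finRotate 3), fun _ => sq)
  | n + 1 => iterate (xGen n)

/-- `yGen n` is the typed permutation `y_{n+1}` of level `n + 1`: the `n`-th iterate of `(0,1)(2)`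
with type `[n,2][s,1]`. -/
def yGen : (n : ℕ) → TypedPerm (n + 1)
  | 0 => (levelOne (swap 0 1), fun v => if v 0 = 2 then sq else nsq)
  | n + 1 => iterate (yGen n)

/-- `zGen n` is the typed permutation `z_{n+1}` of level `n + 1`: the `n`-th iterate of
`(0)(1)(2)` with type `[n,1][n,1][s,1]`. -/
def zGen : (n : ℕ) → TypedPerm (n + 1)
  | 0 => (levelOne 1, fun v => if v 0 = 2 then sq else nsq)
  | n + 1 => iterate (zGen n)

/-! ## The Markov groups -/

/-- The embedding `σ ↦ (σ, id, id)`: `σ` acts on the subtree of words starting with `0`. -/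
def embedFun {n : ℕ} (σ : Perm (Word n)) (v : Word (n + 1)) : Word (n + 1) :=
  if v 0 = 0 then Fin.cons (α := fun _ => Fin 3) 0 (σ (Fin.tail v)) else v

lemma embedFun_comp {n : ℕ} (σ τ : Perm (Word n)) (v : Word (n + 1)) :
    embedFun σ (embedFun τ v) = embedFun (σ * τ) v := by
  unfold embedFun
  by_cases h : v 0 = 0 <;> simp [h]

lemma embedFun_one {n : ℕ} (v : Word (n + 1)) : embedFun 1 v = v := by
  unfold embedFun
  by_cases h : v 0 = 0
  · simp only [h, if_true, Perm.one_apply]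
    conv_rhs => rw [← Fin.cons_self_tail v, h]
  · simp [h]

/-- The embedding `σ ↦ (σ, id, id)` as a group homomorphism. -/
def embed (n : ℕ) : Perm (Word n) →* Perm (Word (n + 1)) where
  toFun σ :=
    { toFun := embedFun σ
      invFun := embedFun σ⁻¹
      left_inv := fun v => by rw [embedFun_comp, inv_mul_cancel, embedFun_one]
      right_inv := fun v => by rw [embedFun_comp, mul_inv_cancel, embedFun_one] }
  map_one' := by ext1 v; exact embedFun_one v
  map_mul' σ τ := by ext1 v; exact (embedFun_comp σ τ v).symm

/-- The subgroup generated by the conjugates of the elements of `S` by the elements of `L`: for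
`S ⊆ L` this is the normal closure of `S` in `L`. -/
def normalClosureIn {G : Type*} [Group G] (L : Subgroup G) (S : Set G) : Subgroup G :=
  Subgroup.closure {g | ∃ l ∈ L, ∃ a ∈ S, g = l * a * l⁻¹}

/-- `L_n = ⟨x_n, z_n, L_{n-1}⟩`, and `L_0` is trivial. -/
def groupL : (n : ℕ) → Subgroup (Perm (Word n))
  | 0 => ⊥
  | n + 1 => Subgroup.closure {(xGen n).1, (zGen n).1} ⊔ (groupL n).map (embed n)

/-- `groupM n` is `M_{n+1} = ⟨x_{n+1}, y_{n+1}, z_{n+1}, L_n⟩`. -/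
def groupM (n : ℕ) : Subgroup (Perm (Word (n + 1))) :=
  Subgroup.closure {(xGen n).1, (yGen n).1, (zGen n).1} ⊔ (groupL n).map (embed n)

/-- `groupH n` is `H_{n+1}`, the normal closure of `L_n` in `L_{n+1}`. -/
def groupH (n : ℕ) : Subgroup (Perm (Word (n + 1))) :=
  normalClosureIn (groupL (n + 1)) ((groupL n).map (embed n) : Set (Perm (Word (n + 1))))

/-- `groupK n` is `K_{n+1}`, the normal closure of `⟨H_{n+1}, z_{n+1}⟩` in `L_{n+1}`. -/
def groupK (n : ℕ) : Subgroup (Perm (Word (n + 1))) :=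
  normalClosureIn (groupL (n + 1)) ((groupH n : Set (Perm (Word (n + 1)))) ∪ {(zGen n).1})

/-- `groupKY n` is `⟨K_{n+1}, y_{n+1}⟩`. -/
def groupKY (n : ℕ) : Subgroup (Perm (Word (n + 1))) :=
  groupK n ⊔ Subgroup.closure {(yGen n).1}

/-- The cycle data of a permutation: the multiset of its cycle lengths, fixed points included. -/
def cycleData {n : ℕ} (σ : Perm (Word n)) : Multiset ℕ := σ.partition.parts

/-- The groups `G n` (of level `n + 1`) consist of tree automorphisms and realize the Markov process
with initial data `init`: at every level, each cycle data `c` occurs in the group with frequency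
equal to the probability of the partition `c` in the corresponding step of the process (the initial
data being the data of level one). -/
def RealizesModel (G : (n : ℕ) → Subgroup (Perm (Word (n + 1)))) (init : PMF TypeSeq) : Prop :=
  ∀ n : ℕ, G n ≤ treeAut (n + 1) ∧
    ∀ c : Multiset ℕ,
      (Nat.card {g : G n // cycleData (g : Perm (Word (n + 1))) = c} : ℝ≥0∞) / Nat.card (G n) =
        ((markov init n).map sizes) c

end CubicMarkov

end

noncomputable section

namespace CubicMarkov

/-! All four families of groups obey one rule: wherever the local permutations at a vertex and at
its three children are all defined, the sign at the vertex is the product of the signs at the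
children. `rootedAut n R` consists of the automorphisms of level `n + 1` that obey the rule and
permute the first letter by an element of `R`. The four groups are the cases where `R` is trivial,
`A₃`, generated by the transposition `(0,1)`, or all of `S₃` (`groupK_eq`, `groupL_succ`,
`groupKY_eq`, `groupM_eq`).

The generators obey the rule because the label of a cycle can be read as a sign carried by its last
vertex: iteration puts a permutation of exactly that sign there, and the new labels, moved to the
new last vertices, again multiply correctly (`lastLabel_iterate_mem`). Conversely, conjugation by
`x` spreads the copy of `L` below the vertex `0` to all three subtrees, `z` and its conjugates
supply the missing sign patterns, and `x`, `y` supply the root permutations (`rootedAut_bot_le`,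
`rootedAut_le`).

For the cycle statistics, attach signs to the vertices of the last level as well, the three signs
below a vertex multiplying to the sign of its local permutation. A uniform object of the next level
then arises by choosing, independently at each vertex of sign `c`, a uniform pair of a permutation
of sign `c` and three signs of product `c` (`uniform_typedFinset_succ`). Along a cycle of length `k`
with sign product `c`, the composite of these pairs is again uniform among pairs of sign `c`
(`map_pathData`), and the cycles above it are those of the composite, with lengths multiplied by `k`
(`orbitData_localExt`). The cycles of one uniform pair follow the transition law of one part
(`map_uniform_localSet`), and distinct cycles are independent, so one level is one step of the
process (`map_orbitData_localExt`). Forgetting the signs of the last level has fibres of constant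
size, so the group elements are uniform too (`realizesModel_rootedAut`). What remains is a finite
count at the root. -/

/-! ## Tree automorphisms as wreath recursions -/

/-- The permutation of level `n + 1` which permutes the first letter by `π` and acts by `τ j` on the
words below the vertex `j`. -/
def wreath {n : ℕ} (π : Perm (Fin 3)) (τ : Fin 3 → Perm (Word n)) : Perm (Word (n + 1)) where
  toFun v := Fin.cons (α := fun _ => Fin 3) (π (v 0)) (τ (v 0) (Fin.tail v))
  invFun v := Fin.cons (α := fun _ => Fin 3) (π⁻¹ (v 0)) ((τ (π⁻¹ (v 0)))⁻¹ (Fin.tail v))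
  left_inv v := by simp
  right_inv v := by simp

lemma wreath_apply {n : ℕ} (π : Perm (Fin 3)) (τ : Fin 3 → Perm (Word n)) (v : Word (n + 1)) :
    wreath π τ v = Fin.cons (α := fun _ => Fin 3) (π (v 0)) (τ (v 0) (Fin.tail v)) := rfl

lemma wreath_mul {n : ℕ} (π π' : Perm (Fin 3)) (τ τ' : Fin 3 → Perm (Word n)) :
    wreath π τ * wreath π' τ' = wreath (π * π') (fun j => τ (π' j) * τ' j) := by
  ext1 v
  simp [wreath_apply]

lemma wreath_one {n : ℕ} : wreath (n := n) 1 (fun _ => 1) = 1 := by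
  ext1 v
  simp [wreath_apply]

lemma wreath_inv {n : ℕ} (π : Perm (Fin 3)) (τ : Fin 3 → Perm (Word n)) :
    (wreath π τ)⁻¹ = wreath π⁻¹ (fun j => (τ (π⁻¹ j))⁻¹) := by
  rw [inv_eq_iff_mul_eq_one, wreath_mul]
  simp [wreath_one]

lemma embed_eq_wreath {n : ℕ} (σ : Perm (Word n)) :
    embed n σ = wreath 1 (Pi.mulSingle 0 σ) := by
  ext1 v
  change embedFun σ v = _
  rw [wreath_apply, embedFun]
  split_ifs with h
  · simp [h]
  · rw [Pi.mulSingle_eq_of_ne h]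
    simp

/-- The permutations of level `n + 1` whose action on the first letter is in `R` and whose sections
are in `E`, with a family of signs whose product is the sign of the action on the first letter. -/
def wreathSet {n : ℕ} (E : ℤˣ → Set (Perm (Word n))) (R : Set (Perm (Fin 3))) :
    Set (Perm (Word (n + 1))) :=
  {σ | ∃ π ∈ R, ∃ (τ : Fin 3 → Perm (Word n)) (e : Fin 3 → ℤˣ),
    ∏ j, e j = Perm.sign π ∧ (∀ j, τ j ∈ E (e j)) ∧ σ = wreath π τ}

/-- The tree automorphisms of level `n` such that at each vertex above level `n - 1`, the sign of
the local permutation is the product of the signs of the local permutations at the three children,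
and the sign at the root is `c`. -/
def signedAut : (n : ℕ) → ℤˣ → Set (Perm (Word n))
  | 0, _ => Set.univ
  | n + 1, c => wreathSet (signedAut n) {π | Perm.sign π = c}

/-- The right factor permutes the signs of the left one, which does not change their product. -/
lemma mul_mem_wreathSet {n : ℕ} {E : ℤˣ → Set (Perm (Word n))}
    (hE : ∀ c c' σ σ', σ ∈ E c → σ' ∈ E c' → σ * σ' ∈ E (c * c'))
    {R R' R'' : Set (Perm (Fin 3))} (hR : ∀ π ∈ R, ∀ π' ∈ R', π * π' ∈ R'')
    {σ σ' : Perm (Word (n + 1))} (hσ : σ ∈ wreathSet E R) (hσ' : σ' ∈ wreathSet E R') :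
    σ * σ' ∈ wreathSet E R'' := by
  obtain ⟨π, hπ, τ, e, he, hτ, rfl⟩ := hσ
  obtain ⟨π', hπ', τ', e', he', hτ', rfl⟩ := hσ'
  refine ⟨π * π', hR _ hπ _ hπ', _, fun j => e (π' j) * e' j, ?_, fun j => hE _ _ _ _ (hτ _) (hτ' _),
    wreath_mul _ _ _ _⟩
  rw [Finset.prod_mul_distrib, Equiv.prod_comp π' e, he, he', Perm.sign_mul]

lemma inv_mem_wreathSet {n : ℕ} {E : ℤˣ → Set (Perm (Word n))}
    (hE : ∀ c σ, σ ∈ E c → σ⁻¹ ∈ E c)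
    {R R' : Set (Perm (Fin 3))} (hR : ∀ π ∈ R, π⁻¹ ∈ R')
    {σ : Perm (Word (n + 1))} (hσ : σ ∈ wreathSet E R) : σ⁻¹ ∈ wreathSet E R' := by
  obtain ⟨π, hπ, τ, e, he, hτ, rfl⟩ := hσ
  refine ⟨π⁻¹, hR _ hπ, _, fun j => e (π⁻¹ j), ?_, fun j => hE _ _ (hτ _), wreath_inv _ _⟩
  rw [Equiv.prod_comp π⁻¹ e, he, Perm.sign_inv]

lemma mul_mem_signedAut : ∀ {n : ℕ} (c c' : ℤˣ) (σ σ' : Perm (Word n)),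
    σ ∈ signedAut n c → σ' ∈ signedAut n c' → σ * σ' ∈ signedAut n (c * c')
  | 0, _, _, _, _, _, _ => trivial
  | _ + 1, _, _, _, _, h, h' => mul_mem_wreathSet mul_mem_signedAut
      (fun _ h _ h' => by simp_all) h h'

lemma inv_mem_signedAut : ∀ {n : ℕ} (c : ℤˣ) (σ : Perm (Word n)),
    σ ∈ signedAut n c → σ⁻¹ ∈ signedAut n c
  | 0, _, _, _ => trivial
  | _ + 1, _, _, h => inv_mem_wreathSet inv_mem_signedAut (fun _ h => by simp_all) h

lemma one_mem_signedAut : ∀ n : ℕ, 1 ∈ signedAut n 1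
  | 0 => trivial
  | n + 1 => ⟨1, by simp, fun _ => 1, fun _ => 1, by simp, fun _ => one_mem_signedAut n,
      wreath_one.symm⟩

lemma conj_mem_signedAut {n : ℕ} {c c' : ℤˣ} {σ τ : Perm (Word n)} (hσ : σ ∈ signedAut n c)
    (hτ : τ ∈ signedAut n c') : σ * τ * σ⁻¹ ∈ signedAut n c' := by
  have := mul_mem_signedAut _ _ _ _ (mul_mem_signedAut _ _ _ _ hσ hτ) (inv_mem_signedAut _ _ hσ)
  rwa [mul_comm c c', mul_assoc, Int.units_mul_self, mul_one] at this

/-- The group of permutations of level `n + 1` satisfying the sign conditions of `signedAut` and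
acting on the first letter by an element of `R`. -/
def rootedAut (n : ℕ) (R : Subgroup (Perm (Fin 3))) : Subgroup (Perm (Word (n + 1))) where
  carrier := wreathSet (signedAut n) R
  mul_mem' := mul_mem_wreathSet mul_mem_signedAut (fun _ h _ h' => mul_mem h h')
  one_mem' := ⟨1, one_mem R, fun _ => 1, fun _ => 1, by simp, fun _ => one_mem_signedAut n,
    wreath_one.symm⟩
  inv_mem' := inv_mem_wreathSet inv_mem_signedAut (fun _ h => inv_mem h)

lemma signedAut_succ_one (n : ℕ) :
    signedAut (n + 1) 1 = (rootedAut n (alternatingGroup (Fin 3)) : Set (Perm (Word (n + 1)))) :=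
  rfl

lemma rootedAut_mono {n : ℕ} {R R' : Subgroup (Perm (Fin 3))} (h : R ≤ R') :
    rootedAut n R ≤ rootedAut n R' := by
  rintro _ ⟨π, hπ, hτ⟩
  exact ⟨π, h hπ, hτ⟩

/-! ### The groups are groups of tree automorphisms -/

lemma wreath_mem_treeAut {n : ℕ} (π : Perm (Fin 3)) {τ : Fin 3 → Perm (Word n)}
    (hτ : ∀ j, τ j ∈ treeAut n) : wreath π τ ∈ treeAut (n + 1) := by
  intro k v w
  rcases k with _ | k
  · simp
  · simp only [Fin.forall_fin_succ, wreath_apply, Fin.cons_zero, Fin.cons_succ, Fin.val_zero,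
      Nat.succ_pos, forall_true_left, Fin.val_succ, Nat.add_lt_add_iff_right,
      EmbeddingLike.apply_eq_iff_eq]
    refine and_congr_right fun h => ?_
    rw [h]
    exact hτ _ k (Fin.tail v) (Fin.tail w)

lemma signedAut_subset_treeAut : ∀ (n : ℕ) (c : ℤˣ), signedAut n c ⊆ treeAut n
  | 0, _ => fun _ _ _ _ _ => by simp
  | n + 1, _ => by
    rintro _ ⟨π, -, τ, e, -, hτ, rfl⟩
    exact wreath_mem_treeAut π fun j => signedAut_subset_treeAut n _ (hτ j)

lemma rootedAut_le_treeAut (n : ℕ) (R : Subgroup (Perm (Fin 3))) :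
    rootedAut n R ≤ treeAut (n + 1) := by
  rintro _ ⟨π, -, τ, e, -, hτ, rfl⟩
  exact wreath_mem_treeAut π fun j => signedAut_subset_treeAut n _ (hτ j)

/-! ### Generation of the groups -/

/-- An element fixing the first letter has one of four sign patterns of product `1`. The trivial
pattern is covered by the three conjugate copies of `signedAut n 1`, the other three by `wreath 1 ζ`
and its conjugates, up to an element of trivial pattern. -/
lemma rootedAut_bot_le {n : ℕ} {S : Subgroup (Perm (Word (n + 1)))}
    (hS : ∀ τ ∈ signedAut n 1, embed n τ ∈ S)
    {ξ ζ : Fin 3 → Perm (Word n)} {e : Fin 3 → ℤˣ} (hξ : ∀ j, ξ j ∈ signedAut n (e j))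
    (hx : ∀ g ∈ S, wreath (finRotate 3) ξ * g * (wreath (finRotate 3) ξ)⁻¹ ∈ S)
    (hζ₀ : ζ 0 ∈ signedAut n (-1)) (hζ₁ : ζ 1 ∈ signedAut n (-1)) (hζ₂ : ζ 2 ∈ signedAut n 1)
    (hz : wreath 1 ζ ∈ S) : rootedAut n ⊥ ≤ S := by
  have conj : ∀ τ : Fin 3 → Perm (Word n), wreath (finRotate 3) ξ * wreath 1 τ *
      (wreath (finRotate 3) ξ)⁻¹ = wreath 1 (fun j => ξ ((finRotate 3)⁻¹ j) *
        τ ((finRotate 3)⁻¹ j) * (ξ ((finRotate 3)⁻¹ j))⁻¹) := by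
    intro τ
    rw [wreath_inv, wreath_mul, wreath_mul]
    simp
  have shift : ∀ j, (∀ τ ∈ signedAut n 1, wreath 1 (Pi.mulSingle j τ) ∈ S) →
      ∀ τ ∈ signedAut n 1, wreath 1 (Pi.mulSingle (finRotate 3 j) τ) ∈ S := by
    intro j hj τ hτ
    -- Conjugation by the rotation also conjugates the section by `ξ j`; this is undone in advance.
    have h1 : (ξ j)⁻¹ * τ * ξ j ∈ signedAut n 1 := by
      simpa using conj_mem_signedAut (inv_mem_signedAut _ _ (hξ j)) hτ
    have h2 := hx _ (hj _ h1)
    rw [conj] at h2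
    convert h2 using 2
    ext1 i
    by_cases hi : i = finRotate 3 j
    · subst hi
      simp [mul_assoc]
    · have hi' : (finRotate 3)⁻¹ i ≠ j := fun h => hi (by rw [← h]; simp)
      rw [Pi.mulSingle_eq_of_ne hi, Pi.mulSingle_eq_of_ne hi']
      simp
  have s0 : ∀ τ ∈ signedAut n 1, wreath 1 (Pi.mulSingle 0 τ) ∈ S := fun τ hτ =>
    embed_eq_wreath τ ▸ hS τ hτ
  have s1 := shift 0 s0
  have s2 := shift _ s1
  have f0 : finRotate 3 0 = 1 := by decide
  have f1 : finRotate 3 1 = 2 := by decide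
  rw [f0] at s1
  rw [f0, f1] at s2
  have base : ∀ τ : Fin 3 → Perm (Word n), (∀ j, τ j ∈ signedAut n 1) → wreath 1 τ ∈ S := by
    intro τ hτ
    have : wreath 1 τ = wreath 1 (Pi.mulSingle 0 (τ 0)) * wreath 1 (Pi.mulSingle 1 (τ 1)) *
        wreath 1 (Pi.mulSingle 2 (τ 2)) := by
      rw [wreath_mul, wreath_mul]
      congr 1
      ext1 j
      fin_cases j <;> simp
    rw [this]
    exact mul_mem (mul_mem (s0 _ (hτ 0)) (s1 _ (hτ 1))) (s2 _ (hτ 2))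
  -- Two elements with the same sign pattern differ by one of trivial pattern, so a single
  -- representative per pattern suffices.
  have patch : ∀ (d : Fin 3 → ℤˣ) (ρ τ : Fin 3 → Perm (Word n)), (∀ j, ρ j ∈ signedAut n (d j)) →
      (∀ j, τ j ∈ signedAut n (d j)) → wreath 1 ρ ∈ S → wreath 1 τ ∈ S := by
    intro d ρ τ hρ hτ h
    have h3 : wreath 1 (fun j => (ρ j)⁻¹ * τ j) ∈ S := base _ fun j => by
      have := mul_mem_signedAut _ _ _ _ (inv_mem_signedAut _ _ (hρ j)) (hτ j)
      rwa [Int.units_mul_self] at this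
    have h4 := mul_mem h h3
    rw [wreath_mul] at h4
    simpa using h4
  have hζ : ∀ j, ζ j ∈ signedAut n ((![-1, -1, 1] : Fin 3 → ℤˣ) j) := by
    intro j
    fin_cases j <;> assumption
  have hz1 := hx _ hz
  have hz2 := hx _ hz1
  rw [conj] at hz1
  rw [conj, conj] at hz2
  have hζ' := fun j => conj_mem_signedAut (hξ ((finRotate 3)⁻¹ j)) (hζ ((finRotate 3)⁻¹ j))
  have hζ'' := fun j => conj_mem_signedAut (hξ ((finRotate 3)⁻¹ j)) (hζ' ((finRotate 3)⁻¹ j))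
  rintro _ ⟨π, hπ, τ, d, hd, hτ, rfl⟩
  obtain rfl : π = 1 := hπ
  rw [Perm.sign_one, Fin.prod_univ_three] at hd
  have cases : ∀ d : Fin 3 → ℤˣ, d 0 * d 1 * d 2 = 1 → d = (fun _ => 1) ∨ d = ![-1, -1, 1] ∨
      d = (fun j => (![-1, -1, 1] : Fin 3 → ℤˣ) ((finRotate 3)⁻¹ j)) ∨
      d = (fun j => (![-1, -1, 1] : Fin 3 → ℤˣ) ((finRotate 3)⁻¹ ((finRotate 3)⁻¹ j))) := by
    decide
  rcases cases d hd with h | h | h | h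
  · exact base τ (by simpa [h] using hτ)
  · exact patch d _ τ (by simpa [h] using hζ) hτ hz
  · exact patch d _ τ (by rw [h]; exact hζ') hτ hz1
  · exact patch d _ τ (by rw [h]; exact hζ'') hτ hz2

/-! ## Permutations with a sign at each vertex -/

/-- The possible local data at a vertex with sign `c`: a permutation of the children with sign `c`
and a sign at each child, with product `c`. -/
def localSet (c : ℤˣ) : Finset (Perm (Fin 3) × (Fin 3 → ℤˣ)) :=
  Finset.univ.filter fun p => Perm.sign p.1 = c ∧ ∏ j, p.2 j = c

lemma mem_localSet {c : ℤˣ} {p : Perm (Fin 3) × (Fin 3 → ℤˣ)} :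
    p ∈ localSet c ↔ Perm.sign p.1 = c ∧ ∏ j, p.2 j = c := by
  simp [localSet]

/-- The typed permutation of level `n + 1` built from a permutation of the first letter and typed
permutations of the three subtrees. -/
def graft {n : ℕ} (π : Perm (Fin 3)) (h : Fin 3 → TypedPerm n) : TypedPerm (n + 1) :=
  (wreath π fun j => (h j).1, fun v => (h (v 0)).2 (Fin.tail v))

/-- The typed permutation of level `n + 1` obtained from a permutation of level `n` and local data at
each vertex of level `n`. -/
def refine {n : ℕ} (g : TypedPerm n) (f : Word n → Perm (Fin 3) × (Fin 3 → ℤˣ)) :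
    TypedPerm (n + 1) :=
  (extend (fun w => (f w).1) g.1, fun v => (f (Fin.init v)).2 (v (Fin.last n)))

lemma extend_apply {n : ℕ} (s : Word n → Perm (Fin 3)) (σ : Perm (Word n)) (v : Word (n + 1)) :
    extend s σ v = Fin.snoc (α := fun _ => Fin 3) (σ (Fin.init v))
      (s (Fin.init v) (v (Fin.last n))) := rfl

/-- Grafting acts at the first letter and refining at the last one, so the two commute. -/
lemma graft_refine {n : ℕ} (π : Perm (Fin 3)) (h : Fin 3 → TypedPerm n)
    (f : Fin 3 → Word n → Perm (Fin 3) × (Fin 3 → ℤˣ)) :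
    graft π (fun j => refine (h j) (f j)) =
      refine (graft π h) (fun w => f (w 0) (Fin.tail w)) := by
  refine Prod.ext ?_ ?_
  · ext1 v
    simp only [graft, refine, wreath_apply, extend_apply]
    rw [Fin.cons_snoc_eq_snoc_cons]
    rfl
  · rfl

/-- The grafts of typed permutations in `E`, with root data in `P`. -/
def typedWreath {n : ℕ} (E : ℤˣ → Set (TypedPerm n)) (P : Set (Perm (Fin 3) × (Fin 3 → ℤˣ))) :
    Set (TypedPerm (n + 1)) :=
  {g | ∃ p ∈ P, ∃ h : Fin 3 → TypedPerm n, (∀ j, h j ∈ E (p.2 j)) ∧ g = graft p.1 h}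

/-- The elements of `signedAut n c`, with a compatible choice of signs at the vertices of
level `n`. -/
def typedAut : (n : ℕ) → ℤˣ → Set (TypedPerm n)
  | 0, c => {(1, fun _ => c)}
  | n + 1, c => typedWreath (typedAut n) (localSet c)

/-- The refinements of the elements of `E` by local data compatible with their labels. -/
def refinements {n : ℕ} (E : Set (TypedPerm n)) : Set (TypedPerm (n + 1)) :=
  {g | ∃ h ∈ E, ∃ f : Word n → Perm (Fin 3) × (Fin 3 → ℤˣ),
    (∀ w, f w ∈ localSet (h.2 w)) ∧ g = refine h f}

lemma typedWreath_refinements {n : ℕ} (E : ℤˣ → Set (TypedPerm n))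
    (P : Set (Perm (Fin 3) × (Fin 3 → ℤˣ))) :
    typedWreath (fun c => refinements (E c)) P = refinements (typedWreath E P) := by
  ext g
  constructor
  · rintro ⟨p, hp, h, hh, rfl⟩
    choose k hk f hf hkf using hh
    refine ⟨graft p.1 k, ⟨p, hp, k, hk, rfl⟩, _, fun w => hf (w 0) (Fin.tail w), ?_⟩
    rw [← graft_refine]
    congr 1
    ext1 j
    exact hkf j
  · rintro ⟨_, ⟨p, hp, k, hk, rfl⟩, f, hf, rfl⟩
    refine ⟨p, hp, fun j => refine (k j) (fun w => f (Fin.cons j w)),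
      fun j => ⟨k j, hk j, _, fun w => ?_, rfl⟩, ?_⟩
    · simpa [graft] using hf (Fin.cons j w)
    · rw [graft_refine]
      simp

/-- The root label `c` is arbitrary because `refine` never reads the old labels. This permits a set
`P` containing root data of both signs. -/
lemma typedWreath_typedAut_zero (P : Set (Perm (Fin 3) × (Fin 3 → ℤˣ))) (c : ℤˣ) :
    typedWreath (typedAut 0) P = {g | ∃ p ∈ P, g = refine (1, fun _ => c) (fun _ => p)} := by
  ext g
  have key : ∀ p : Perm (Fin 3) × (Fin 3 → ℤˣ),
      graft p.1 (fun j => (1, fun _ => p.2 j)) = refine (n := 0) (1, fun _ => c) (fun _ => p) := by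
    intro p
    refine Prod.ext ?_ ?_
    · ext1 v
      funext i
      rw [Fin.fin_one_eq_zero i]
      rfl
    · rfl
  constructor
  · rintro ⟨p, hp, h, hh, rfl⟩
    refine ⟨p, hp, ?_⟩
    rw [← key]
    congr 1
    ext1 j
    exact hh j
  · rintro ⟨p, hp, rfl⟩
    exact ⟨p, hp, fun j => (1, fun _ => p.2 j), fun j => rfl, (key p).symm⟩

/-- The groups are recursive at the root, whereas iteration and the Markov process add a level at
the leaves; this identity converts one recursion into the other. -/
lemma typedAut_succ : ∀ (n : ℕ) (c : ℤˣ), typedAut (n + 1) c = refinements (typedAut n c)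
  | 0, c => by
    refine (typedWreath_typedAut_zero _ c).trans ?_
    ext g
    constructor
    · rintro ⟨p, hp, rfl⟩
      exact ⟨_, rfl, _, fun _ => hp, rfl⟩
    · rintro ⟨_, rfl, f, hf, rfl⟩
      refine ⟨f default, hf default, ?_⟩
      congr 1
      ext1 w
      rw [Subsingleton.elim w default]
  | n + 1, c => by
    exact (congrArg (fun E => typedWreath E (localSet c)) (funext (typedAut_succ n))).trans
      (typedWreath_refinements _ _)

/-- The typed permutations of level `n + 1` with root data in `P`. -/
def rootedTyped (n : ℕ) (P : Set (Perm (Fin 3) × (Fin 3 → ℤˣ))) : Set (TypedPerm (n + 1)) :=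
  typedWreath (typedAut n) P

lemma rootedTyped_succ (n : ℕ) (P : Set (Perm (Fin 3) × (Fin 3 → ℤˣ))) :
    rootedTyped (n + 1) P = refinements (rootedTyped n P) := by
  rw [rootedTyped, funext (typedAut_succ n), typedWreath_refinements, rootedTyped]

lemma mem_signedAut_iff : ∀ {n : ℕ} {c : ℤˣ} {σ : Perm (Word n)},
    σ ∈ signedAut n c ↔ ∃ ε, (σ, ε) ∈ typedAut n c
  | 0, c, σ => iff_of_true trivial ⟨fun _ => c, by
      rw [Subsingleton.elim σ 1]; rfl⟩
  | n + 1, c, σ => by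
    constructor
    · rintro ⟨π, hπ, τ, e, he, hτ, rfl⟩
      choose ε hε using fun j => mem_signedAut_iff.1 (hτ j)
      exact ⟨_, (π, e), mem_localSet.2 ⟨hπ, he.trans hπ⟩, _, hε, rfl⟩
    · rintro ⟨ε, p, hp, h, hh, hg⟩
      obtain ⟨h1, h2⟩ := mem_localSet.1 hp
      exact ⟨p.1, h1, fun j => (h j).1, p.2, h2.trans h1.symm,
        fun j => mem_signedAut_iff.2 ⟨(h j).2, hh j⟩, congrArg Prod.fst hg⟩

/-- The root data of `rootedAut n R`. -/
def rootData (R : Subgroup (Perm (Fin 3))) : Set (Perm (Fin 3) × (Fin 3 → ℤˣ)) :=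
  {p | p.1 ∈ R ∧ ∏ j, p.2 j = Perm.sign p.1}

lemma mem_rootedAut_iff {n : ℕ} {R : Subgroup (Perm (Fin 3))} {σ : Perm (Word (n + 1))} :
    σ ∈ rootedAut n R ↔ ∃ ε, (σ, ε) ∈ rootedTyped n (rootData R) := by
  constructor
  · rintro ⟨π, hπ, τ, e, he, hτ, rfl⟩
    choose ε hε using fun j => mem_signedAut_iff.1 (hτ j)
    exact ⟨_, (π, e), ⟨hπ, he⟩, _, hε, rfl⟩
  · rintro ⟨ε, p, hp, h, hh, hg⟩
    exact ⟨p.1, hp.1, fun j => (h j).1, p.2, hp.2,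
      fun j => mem_signedAut_iff.2 ⟨(h j).2, hh j⟩, congrArg Prod.fst hg⟩

/-! ### The generators -/

open Classical in
/-- The typed permutation in which the label of each cycle is moved to its last vertex, all other
vertices having label `1`. -/
def lastLabel {n : ℕ} (g : TypedPerm n) : TypedPerm n :=
  (g.1, fun w => if IsLastInCycle g.1 w then g.2 w else 1)

/-! ### Last vertices of cycles under iteration. -/

lemma toLex_snoc_lt {n : ℕ} {v w : Word n} (i j : Fin 3) (h : toLex v < toLex w) :
    toLex (Fin.snoc (α := fun _ => Fin 3) v i : Word (n + 1)) <
      toLex (Fin.snoc (α := fun _ => Fin 3) w j : Word (n + 1)) := by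
  obtain ⟨k, hk, hlt⟩ := h
  refine ⟨k.castSucc, fun l hl => ?_, ?_⟩
  · obtain ⟨l, rfl⟩ := Fin.exists_castSucc_eq.2 (hl.trans_le (Fin.le_last _)).ne
    simpa using hk l (by simpa using hl)
  · simpa using hlt

lemma toLex_le_of_snoc_le {n : ℕ} {v w : Word n} {i j : Fin 3}
    (h : toLex (Fin.snoc (α := fun _ => Fin 3) v i : Word (n + 1)) ≤
      toLex (Fin.snoc (α := fun _ => Fin 3) w j : Word (n + 1))) : toLex v ≤ toLex w :=
  le_of_not_gt fun hlt => (toLex_snoc_lt j i hlt).not_ge h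

lemma toLex_snoc_zero_le {n : ℕ} {v w : Word n} (j : Fin 3) (h : toLex v ≤ toLex w) :
    toLex (Fin.snoc (α := fun _ => Fin 3) v 0 : Word (n + 1)) ≤
      toLex (Fin.snoc (α := fun _ => Fin 3) w j : Word (n + 1)) := by
  rcases h.lt_or_eq with h | h
  · exact (toLex_snoc_lt _ _ h).le
  · obtain rfl : v = w := h
    refine Pi.toLex_monotone fun k => ?_
    refine Fin.lastCases ?_ (fun k => ?_) k <;> simp

lemma iterate_snoc {n : ℕ} (g : TypedPerm n) (w : Word n) (j : Fin 3) :
    (∃ i, (iterate g).1 (Fin.snoc (α := fun _ => Fin 3) w j) =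
      Fin.snoc (α := fun _ => Fin 3) (g.1 w) i) := by
  simp [iterate, extend_apply]

lemma iterate_pow_snoc {n : ℕ} (g : TypedPerm n) (w : Word n) (j : Fin 3) (k : ℕ) :
    (∃ i, ((iterate g).1 ^ k) (Fin.snoc (α := fun _ => Fin 3) w j) =
      Fin.snoc (α := fun _ => Fin 3) ((g.1 ^ k) w) i) := by
  induction k with
  | zero => exact ⟨j, rfl⟩
  | succ k ih =>
    obtain ⟨i, hi⟩ := ih
    rw [pow_succ', Perm.mul_apply, hi, pow_succ', Perm.mul_apply]
    exact iterate_snoc _ _ _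

lemma isLastInCycle_of_iterate {n : ℕ} {g : TypedPerm n} {w : Word n} {j : Fin 3}
    (h : IsLastInCycle (iterate g).1 (Fin.snoc (α := fun _ => Fin 3) w j)) :
    IsLastInCycle g.1 w := by
  intro k
  obtain ⟨i, hi⟩ := iterate_snoc g w j
  obtain ⟨l, hl⟩ := iterate_pow_snoc g w j k
  have := h k
  rw [hi, hl] at this
  exact toLex_le_of_snoc_le this

lemma iterate_snoc_of_isLast {n : ℕ} {g : TypedPerm n} {w : Word n} (j : Fin 3)
    (hw : IsLastInCycle g.1 w) (hn : g.2 w ≠ sq) :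
    (iterate g).1 (Fin.snoc (α := fun _ => Fin 3) w j) =
      Fin.snoc (α := fun _ => Fin 3) (g.1 w) (swap 0 1 j) := by
  simp [iterate, extend_apply, hw, hn]

lemma iterate_snoc_of_not_isLast {n : ℕ} {g : TypedPerm n} {w : Word n} (j : Fin 3)
    (hw : ¬ IsLastInCycle g.1 w) :
    (iterate g).1 (Fin.snoc (α := fun _ => Fin 3) w j) =
      Fin.snoc (α := fun _ => Fin 3) (g.1 w) j := by
  simp [iterate, extend_apply, hw]

lemma isLastInCycle_iterate_one {n : ℕ} {g : TypedPerm n} {w : Word n}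
    (hw : IsLastInCycle g.1 w) (hn : g.2 w ≠ sq) :
    IsLastInCycle (iterate g).1 (Fin.snoc (α := fun _ => Fin 3) w 1) := by
  intro k
  obtain ⟨l, hl⟩ := iterate_pow_snoc g w 1 k
  rw [iterate_snoc_of_isLast _ hw hn, hl, swap_apply_right]
  exact toLex_snoc_zero_le _ (hw k)

/-- The doubled cycle starts at `v * 0`, where `v = g.1 w` is the smallest vertex of the old cycle.
It passes through `w * 0` halfway, and only `w * 1` is sent back to the start. -/
lemma not_isLastInCycle_iterate_zero {n : ℕ} {g : TypedPerm n} {w : Word n}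
    (hw : IsLastInCycle g.1 w) (hn : g.2 w ≠ sq) :
    ¬ IsLastInCycle (iterate g).1 (Fin.snoc (α := fun _ => Fin 3) w 0) := by
  set v := g.1 w with hv
  set p := Function.minimalPeriod g.1 v with hp
  have hpos : 0 < p := Function.minimalPeriod_pos_of_mem_periodicPts
    (Function.Injective.mem_periodicPts g.1.injective v)
  have hvp : (g.1 ^ p) v = v := by
    rw [Perm.coe_pow]
    exact Function.isPeriodicPt_minimalPeriod _ _
  -- Before the old cycle closes up, no vertex other than `w` is last in it, so the letter `1` is
  -- carried along unchanged.
  have step : ∀ i < p, ((iterate g).1 ^ i) (Fin.snoc (α := fun _ => Fin 3) v 1) =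
      Fin.snoc (α := fun _ => Fin 3) ((g.1 ^ i) v) 1 := by
    intro i
    induction i with
    | zero => exact fun _ => rfl
    | succ i ih =>
      intro hi
      rw [pow_succ', Perm.mul_apply, ih (by omega), pow_succ', Perm.mul_apply]
      refine iterate_snoc_of_not_isLast _ fun hlast => ?_
      have h1 : toLex ((g.1 ^ (i + 1)) v) ≤ toLex v := by
        have := hlast (p - i)
        have hpi : (g.1 ^ (p - i)) ((g.1 ^ i) v) = v := by
          rw [← Perm.mul_apply, ← pow_add, Nat.sub_add_cancel (by omega), hvp]
        rwa [hpi, ← Perm.mul_apply, ← pow_succ'] at this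
      have h2 : toLex v ≤ toLex ((g.1 ^ (i + 1)) v) := by
        have := hw (i + 1 + 1)
        rwa [pow_succ, Perm.mul_apply] at this
      have h3 : (g.1 ^ (i + 1)) v = v := toLex_inj.1 (le_antisymm h1 h2)
      rw [Perm.coe_pow] at h3
      have := Function.IsPeriodicPt.minimalPeriod_le (Nat.succ_pos i) h3
      omega
  intro hlast
  have hw' : (g.1 ^ (p - 1)) v = w := by
    apply g.1.injective
    rw [← Perm.mul_apply, ← pow_succ', Nat.sub_add_cancel hpos, hvp]
  -- One step leads from `w * 0` to `v * 1`, then `p - 1` steps to `w * 1`, and a final one to `v *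
  -- 0`. Were `w * 0` last, `v * 1` would be at most `v * 0`.
  have := hlast (p + 1)
  rw [pow_succ, Perm.mul_apply, iterate_snoc_of_isLast _ hw hn, swap_apply_left,
    show p = p - 1 + 1 by omega, pow_succ', Perm.mul_apply, ← hv, step _ (by omega), hw',
    iterate_snoc_of_isLast _ hw hn, swap_apply_right] at this
  simpa using Pi.apply_le_of_toLex (i := Fin.last n) this (fun j hj => by
    obtain ⟨j, rfl⟩ := Fin.exists_castSucc_eq.2 hj.ne
    simp [hv])

/-- A 3-cycle has sign `1` and a transposition sign `-1`, matching the label at the last vertex;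
elsewhere both signs are trivial. Above the last vertex `w` of a cycle labelled `n`, exactly one
child, `w * 1`, carries `-1`, so the children multiply to `-1`. -/
lemma lastLabel_iterate_mem {n : ℕ} {E : Set (TypedPerm n)} {g : TypedPerm n}
    (hg : lastLabel g ∈ E) : lastLabel (iterate g) ∈ refinements E := by
  classical
  refine ⟨_, hg, fun w => (if IsLastInCycle g.1 w then
      (if g.2 w = sq then finRotate 3 else swap 0 1) else 1,
      fun j => (lastLabel (iterate g)).2 (Fin.snoc (α := fun _ => Fin 3) w j)), fun w => ?_, ?_⟩
  · rw [mem_localSet, Fin.prod_univ_three]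
    by_cases hs : g.2 w = sq
    · have : ∀ j, (lastLabel (iterate g)).2 (Fin.snoc (α := fun _ => Fin 3) w j) = 1 := by
        intro j
        simp [lastLabel, iterate, hs]
      simp only [this]
      by_cases hw : IsLastInCycle g.1 w <;> simp [lastLabel, hw, hs]
    · have h2 : (lastLabel (iterate g)).2 (Fin.snoc (α := fun _ => Fin 3) w 2) = 1 := by
        simp [lastLabel, iterate]
      rw [h2]
      by_cases hw : IsLastInCycle g.1 w
      · have h0 : (lastLabel (iterate g)).2 (Fin.snoc (α := fun _ => Fin 3) w 0) = 1 :=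
          if_neg (not_isLastInCycle_iterate_zero hw hs)
        have h1 : (lastLabel (iterate g)).2 (Fin.snoc (α := fun _ => Fin 3) w 1) = -1 :=
          (if_pos (isLastInCycle_iterate_one hw hs)).trans (by simp [iterate, hs])
        rw [h0, h1]
        have hn : g.2 w = -1 := (Int.units_eq_one_or _).resolve_left hs
        simp [lastLabel, hw, hn]
      · have h : ∀ j, (lastLabel (iterate g)).2 (Fin.snoc (α := fun _ => Fin 3) w j) = 1 :=
          fun j => if_neg fun h => hw (isLastInCycle_of_iterate h)
        rw [h, h]
        simp [lastLabel, hw]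
  · refine Prod.ext ?_ ?_
    · rfl
    · funext v
      simp [refine]

lemma extend_snoc {n : ℕ} (s : Word n → Perm (Fin 3)) (σ : Perm (Word n)) (w : Word n)
    (j : Fin 3) : extend s σ (Fin.snoc (α := fun _ => Fin 3) w j) =
      Fin.snoc (α := fun _ => Fin 3) (σ w) (s w j) := by
  simp [extend_apply]

lemma extend_inj {n : ℕ} {s s' : Word n → Perm (Fin 3)} {σ σ' : Perm (Word n)} :
    extend s σ = extend s' σ' ↔ s = s' ∧ σ = σ' := by
  refine ⟨fun h => ?_, fun h => by rw [h.1, h.2]⟩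
  have key : ∀ w j, σ w = σ' w ∧ s w j = s' w j := by
    intro w j
    have := DFunLike.congr_fun h (Fin.snoc (α := fun _ => Fin 3) w j)
    rw [extend_snoc, extend_snoc] at this
    exact Fin.snoc_inj.1 this
  exact ⟨funext fun w => Equiv.ext fun j => (key w j).2, Equiv.ext fun w => (key w 0).1⟩

/-! ### Wreath form of the generators. -/

lemma exists_wreath_of_lastLabel_mem {n : ℕ} {P : Set (Perm (Fin 3) × (Fin 3 → ℤˣ))}
    {g : TypedPerm (n + 1)} (hg : lastLabel g ∈ rootedTyped n P) :
    ∃ p ∈ P, ∃ τ : Fin 3 → Perm (Word n), (∀ j, τ j ∈ signedAut n (p.2 j)) ∧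
      g.1 = wreath p.1 τ := by
  obtain ⟨p, hp, h, hh, hg⟩ := hg
  exact ⟨p, hp, fun j => (h j).1, fun j => mem_signedAut_iff.2 ⟨(h j).2, hh j⟩,
    congrArg Prod.fst hg⟩

lemma lastLabel_xGen_mem : ∀ n : ℕ, lastLabel (xGen n) ∈ rootedTyped n {(finRotate 3, fun _ => 1)}
  | 0 => by
    rw [rootedTyped, typedWreath_typedAut_zero _ 1]
    exact ⟨_, rfl, Prod.ext rfl (funext fun v => ite_self _)⟩
  | n + 1 => by
    rw [rootedTyped_succ]
    exact lastLabel_iterate_mem (lastLabel_xGen_mem n)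

lemma lastLabel_yGen_mem : ∀ n : ℕ, lastLabel (yGen n) ∈
    rootedTyped n {p | p.1 = swap 0 1 ∧ ∏ j, p.2 j = -1}
  | 0 => by
    -- The element `y` of level one is itself the iterate of the root with label `n`, so the base
    -- case follows from the iteration lemma.
    have h1 : yGen 0 = iterate (n := 0) (1, fun _ => nsq) := by
      refine Prod.ext ?_ (by simp [yGen, iterate])
      simp [yGen, iterate, levelOne, IsLastInCycle]
    have h2 := lastLabel_iterate_mem (n := 0) (g := (1, fun _ => nsq)) (E := {(1, fun _ => -1)})
      (Prod.ext rfl (by simp [lastLabel, IsLastInCycle]))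
    rw [← h1] at h2
    obtain ⟨_, rfl, f, hf, h⟩ := h2
    rw [rootedTyped, typedWreath_typedAut_zero _ (-1)]
    refine ⟨f default, ⟨?_, (mem_localSet.1 (hf _)).2⟩, ?_⟩
    · have h3 : extend (fun _ => swap 0 1) 1 = extend (fun w => (f w).1) 1 := congrArg Prod.fst h
      exact (congrFun (extend_inj.1 h3).1 default).symm
    · rw [h]
      congr 1
      ext1 w
      rw [Subsingleton.elim w default]
  | n + 1 => by
    rw [rootedTyped_succ]
    exact lastLabel_iterate_mem (lastLabel_yGen_mem n)

lemma lastLabel_zGen_mem : ∀ n : ℕ, lastLabel (zGen n) ∈ rootedTyped n {(1, ![-1, -1, 1])}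
  | 0 => by
    have h1 : levelOne 1 = 1 := by
      ext1 v
      exact Fin.snoc_init_self v
    have h2 : ∀ w : Word 1, IsLastInCycle 1 w := fun w k => by simp
    rw [rootedTyped, typedWreath_typedAut_zero _ 1]
    refine ⟨_, rfl, Prod.ext rfl ?_⟩
    funext v
    have h3 : ∀ i : Fin 3, (if i = 2 then sq else nsq) = (![-1, -1, 1] : Fin 3 → ℤˣ) i := by decide
    have h4 : (lastLabel (zGen 0)).2 v = if v 0 = 2 then sq else nsq :=
      if_pos (by simp only [zGen, h1]; exact h2 v)
    rw [h4]
    exact h3 _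
  | n + 1 => by
    rw [rootedTyped_succ]
    exact lastLabel_iterate_mem (lastLabel_zGen_mem n)

lemma xGen_eq_wreath (n : ℕ) : ∃ ξ : Fin 3 → Perm (Word n), (∀ j, ξ j ∈ signedAut n 1) ∧
    (xGen n).1 = wreath (finRotate 3) ξ := by
  obtain ⟨_, rfl, ξ, h⟩ := exists_wreath_of_lastLabel_mem (lastLabel_xGen_mem n)
  exact ⟨ξ, h⟩

lemma yGen_mem_wreathSet (n : ℕ) : (yGen n).1 ∈ wreathSet (signedAut n) {swap 0 1} := by
  obtain ⟨p, hp, η, h⟩ := exists_wreath_of_lastLabel_mem (lastLabel_yGen_mem n)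
  exact ⟨p.1, hp.1, η, p.2, by rw [hp.1, hp.2, Perm.sign_swap (by decide)], h⟩

lemma zGen_eq_wreath (n : ℕ) : ∃ ζ : Fin 3 → Perm (Word n),
    (∀ j, ζ j ∈ signedAut n ((![-1, -1, 1] : Fin 3 → ℤˣ) j)) ∧ (zGen n).1 = wreath 1 ζ := by
  obtain ⟨_, rfl, ζ, h⟩ := exists_wreath_of_lastLabel_mem (lastLabel_zGen_mem n)
  exact ⟨ζ, h⟩

lemma xGen_mem_wreathSet (n : ℕ) : (xGen n).1 ∈ wreathSet (signedAut n) {finRotate 3} := by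
  obtain ⟨ξ, hξ, h⟩ := xGen_eq_wreath n
  exact ⟨_, rfl, ξ, fun _ => 1, by simp, hξ, h⟩

lemma zGen_mem_rootedAut (n : ℕ) : (zGen n).1 ∈ rootedAut n ⊥ := by
  obtain ⟨ζ, hζ, h⟩ := zGen_eq_wreath n
  exact ⟨1, rfl, ζ, _, by decide, hζ, h⟩

lemma embed_mem_rootedAut {n : ℕ} {σ : Perm (Word n)} (hσ : σ ∈ signedAut n 1) :
    embed n σ ∈ rootedAut n ⊥ := by
  refine ⟨1, rfl, _, fun _ => 1, by simp, fun j => ?_, embed_eq_wreath σ⟩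
  by_cases hj : j = 0
  · subst hj
    simpa using hσ
  · rw [Pi.mulSingle_eq_of_ne hj]
    exact one_mem_signedAut n

lemma mem_rootedAut_of_mem_wreathSet {n : ℕ} {π : Perm (Fin 3)} {R : Subgroup (Perm (Fin 3))}
    (hπ : π ∈ R) {σ : Perm (Word (n + 1))} (hσ : σ ∈ wreathSet (signedAut n) {π}) :
    σ ∈ rootedAut n R := by
  obtain ⟨_, rfl, h⟩ := hσ
  exact ⟨_, hπ, h⟩

lemma rootedAut_bot_le_of_gens {n : ℕ} {S : Subgroup (Perm (Word (n + 1)))}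
    (hS : ∀ τ ∈ signedAut n 1, embed n τ ∈ S) (hx : ∀ g ∈ S, (xGen n).1 * g * (xGen n).1⁻¹ ∈ S)
    (hz : (zGen n).1 ∈ S) : rootedAut n ⊥ ≤ S := by
  obtain ⟨ξ, hξ, hx'⟩ := xGen_eq_wreath n
  obtain ⟨ζ, hζ, hz'⟩ := zGen_eq_wreath n
  rw [hx'] at hx
  rw [hz'] at hz
  exact rootedAut_bot_le hS hξ hx (hζ 0) (hζ 1) (hζ 2) hz

/-- The permutations of the first letter induced by those elements of `S` which satisfy the sign
conditions. -/
def rootImage {n : ℕ} (S : Subgroup (Perm (Word (n + 1)))) : Subgroup (Perm (Fin 3)) where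
  carrier := {π | ∃ g ∈ S, g ∈ wreathSet (signedAut n) {π}}
  mul_mem' := fun ⟨g, hg, hg'⟩ ⟨h, hh, hh'⟩ => ⟨g * h, mul_mem hg hh,
    mul_mem_wreathSet mul_mem_signedAut (by rintro _ rfl _ rfl; rfl) hg' hh'⟩
  one_mem' := ⟨1, one_mem S, one_mem (rootedAut n ⊥)⟩
  inv_mem' := fun ⟨g, hg, hg'⟩ => ⟨g⁻¹, inv_mem hg,
    inv_mem_wreathSet inv_mem_signedAut (by rintro _ rfl; rfl) hg'⟩

/-- Dividing by a lift in `S` of the root permutation leaves an element of `rootedAut n ⊥`. -/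
lemma rootedAut_le {n : ℕ} {S : Subgroup (Perm (Word (n + 1)))} {R : Subgroup (Perm (Fin 3))}
    (h : rootedAut n ⊥ ≤ S) (hR : R ≤ rootImage S) : rootedAut n R ≤ S := by
  rintro _ ⟨π, hπ, hτ⟩
  obtain ⟨g, hg, hg'⟩ := hR hπ
  rw [← S.mul_mem_cancel_left (inv_mem hg)]
  refine h (mul_mem_wreathSet (R := {π⁻¹}) (R' := {π}) mul_mem_signedAut ?_
    (inv_mem_wreathSet inv_mem_signedAut ?_ hg') ⟨π, rfl, hτ⟩)
  · rintro _ rfl _ rfl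
    simp
  · rintro _ rfl
    rfl

/-! ### Identification of the Markov groups. -/

lemma alternatingGroup_le_of_finRotate_mem {R : Subgroup (Perm (Fin 3))} (h : finRotate 3 ∈ R) :
    alternatingGroup (Fin 3) ≤ R := by
  intro π hπ
  have : ∀ π : Perm (Fin 3), Perm.sign π = 1 →
      π = 1 ∨ π = finRotate 3 ∨ π = finRotate 3 * finRotate 3 := by decide
  rcases this π hπ with rfl | rfl | rfl
  · exact one_mem R
  · exact h
  · exact mul_mem h h

lemma top_le_of_finRotate_mem {R : Subgroup (Perm (Fin 3))} (h : finRotate 3 ∈ R)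
    (h' : swap 0 1 ∈ R) : ⊤ ≤ R := by
  intro π _
  have hA := alternatingGroup_le_of_finRotate_mem h
  rcases Int.units_eq_one_or (Perm.sign π) with hπ | hπ
  · exact hA hπ
  · rw [← R.mul_mem_cancel_left h']
    refine hA ?_
    rw [Perm.mem_alternatingGroup, Perm.sign_mul, hπ, Perm.sign_swap (by decide)]
    rfl

lemma groupL_succ_eq {n : ℕ} (ih : (groupL n : Set (Perm (Word n))) = signedAut n 1) :
    groupL (n + 1) = rootedAut n (alternatingGroup (Fin 3)) := by
  have hx : (xGen n).1 ∈ groupL (n + 1) :=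
    Subgroup.mem_sup_left (Subgroup.subset_closure (by simp))
  have hz : (zGen n).1 ∈ groupL (n + 1) :=
    Subgroup.mem_sup_left (Subgroup.subset_closure (by simp))
  refine le_antisymm (sup_le ?_ ?_) (rootedAut_le (rootedAut_bot_le_of_gens ?_ ?_ hz) ?_)
  · rw [Subgroup.closure_le]
    rintro _ (rfl | rfl)
    · exact mem_rootedAut_of_mem_wreathSet (by simp) (xGen_mem_wreathSet n)
    · exact rootedAut_mono bot_le (zGen_mem_rootedAut n)
  · rintro _ ⟨τ, hτ, rfl⟩
    exact rootedAut_mono bot_le (embed_mem_rootedAut (ih ▸ hτ))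
  · intro τ hτ
    exact Subgroup.mem_sup_right ⟨τ, by rwa [ih], rfl⟩
  · exact fun g hg => mul_mem (mul_mem hx hg) (inv_mem hx)
  · exact alternatingGroup_le_of_finRotate_mem ⟨_, hx, xGen_mem_wreathSet n⟩

lemma coe_groupL : ∀ n : ℕ, (groupL n : Set (Perm (Word n))) = signedAut n 1
  | 0 => Set.eq_univ_of_forall fun σ => by
      rw [Subsingleton.elim σ 1]
      exact one_mem _
  | n + 1 => by
    rw [groupL_succ_eq (coe_groupL n), signedAut_succ_one]

lemma groupL_succ (n : ℕ) : groupL (n + 1) = rootedAut n (alternatingGroup (Fin 3)) :=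
  groupL_succ_eq (coe_groupL n)

lemma xGen_mem_groupL (n : ℕ) : (xGen n).1 ∈ groupL (n + 1) :=
  Subgroup.mem_sup_left (Subgroup.subset_closure (by simp))

/-- `rootedAut n ⊥` is the kernel of the action of `groupL (n + 1)` on the first letter, hence
normal there. -/
lemma normalClosureIn_le_rootedAut_bot {n : ℕ} {S : Set (Perm (Word (n + 1)))}
    (hS : S ⊆ rootedAut n ⊥) : normalClosureIn (groupL (n + 1)) S ≤ rootedAut n ⊥ := by
  rw [normalClosureIn, Subgroup.closure_le]
  rintro _ ⟨l, hl, a, ha, rfl⟩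
  rw [groupL_succ] at hl
  obtain ⟨π, hπ, hτ⟩ := hl
  refine mul_mem_wreathSet (R := {π}) (R' := {π⁻¹}) mul_mem_signedAut ?_
    (mul_mem_wreathSet (R := {π}) (R' := {1}) mul_mem_signedAut ?_ ⟨π, rfl, hτ⟩ (hS ha))
    (inv_mem_wreathSet (R := {π}) inv_mem_signedAut ?_ ⟨π, rfl, hτ⟩)
  · rintro _ rfl _ rfl
    simp
  · rintro _ rfl _ rfl
    simp
  · rintro _ rfl
    rfl

lemma conj_mem_normalClosureIn {G : Type*} [Group G] {L : Subgroup G} {S : Set G} {l g : G}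
    (hl : l ∈ L) (hg : g ∈ normalClosureIn L S) : l * g * l⁻¹ ∈ normalClosureIn L S := by
  have : normalClosureIn L S ≤ (normalClosureIn L S).comap (MulAut.conj l).toMonoidHom := by
    conv_lhs => rw [normalClosureIn]
    rw [Subgroup.closure_le]
    rintro _ ⟨m, hm, a, ha, rfl⟩
    refine Subgroup.subset_closure ⟨l * m, mul_mem hl hm, a, ha, ?_⟩
    simp [mul_assoc]
  exact this hg

lemma subset_normalClosureIn {G : Type*} [Group G] (L : Subgroup G) (S : Set G) :
    S ⊆ normalClosureIn L S :=
  fun a ha => Subgroup.subset_closure ⟨1, one_mem L, a, ha, by simp⟩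

lemma groupK_eq (n : ℕ) : groupK n = rootedAut n ⊥ := by
  refine le_antisymm (normalClosureIn_le_rootedAut_bot (Set.union_subset ?_ ?_))
    (rootedAut_bot_le_of_gens ?_ ?_ ?_)
  · refine normalClosureIn_le_rootedAut_bot ?_
    rintro _ ⟨τ, hτ, rfl⟩
    exact embed_mem_rootedAut (coe_groupL n ▸ hτ)
  · rintro _ rfl
    exact zGen_mem_rootedAut n
  · intro τ hτ
    refine subset_normalClosureIn _ _ (Or.inl (subset_normalClosureIn _ _ ⟨τ, ?_, rfl⟩))
    rwa [coe_groupL]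
  · exact fun g hg => conj_mem_normalClosureIn (xGen_mem_groupL n) hg
  · exact subset_normalClosureIn _ _ (Or.inr rfl)

lemma groupKY_eq (n : ℕ) : groupKY n = rootedAut n (Subgroup.zpowers (swap 0 1)) := by
  refine le_antisymm (sup_le ?_ ?_) (rootedAut_le ?_ ?_)
  · rw [groupK_eq]
    exact rootedAut_mono bot_le
  · rw [Subgroup.closure_le]
    rintro _ rfl
    exact mem_rootedAut_of_mem_wreathSet (by simp) (yGen_mem_wreathSet n)
  · rw [← groupK_eq]
    exact le_sup_left
  · rw [Subgroup.zpowers_le]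
    exact ⟨_, Subgroup.mem_sup_right (Subgroup.subset_closure rfl), yGen_mem_wreathSet n⟩

lemma groupM_eq (n : ℕ) : groupM n = rootedAut n ⊤ := by
  have hL : groupL (n + 1) ≤ groupM n :=
    sup_le_sup_right (Subgroup.closure_mono (by intro g; simp; tauto)) _
  have hy : (yGen n).1 ∈ groupM n := Subgroup.mem_sup_left (Subgroup.subset_closure (by simp))
  refine le_antisymm (sup_le ?_ ?_) (rootedAut_le ?_ ?_)
  · rw [Subgroup.closure_le]
    rintro _ (rfl | rfl | rfl)
    · exact mem_rootedAut_of_mem_wreathSet (Subgroup.mem_top _) (xGen_mem_wreathSet n)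
    · exact mem_rootedAut_of_mem_wreathSet (Subgroup.mem_top _) (yGen_mem_wreathSet n)
    · exact rootedAut_mono bot_le (zGen_mem_rootedAut n)
  · rintro _ ⟨τ, hτ, rfl⟩
    exact rootedAut_mono bot_le (embed_mem_rootedAut (coe_groupL n ▸ hτ))
  · refine le_trans ?_ hL
    rw [groupL_succ]
    exact rootedAut_mono bot_le
  · exact top_le_of_finRotate_mem ⟨_, hL (xGen_mem_groupL n), xGen_mem_wreathSet n⟩
      ⟨_, hy, yGen_mem_wreathSet n⟩

/-! ## The labelled cycle data of a permutation -/

open Classical in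
/-- The multiset of the pairs (product of the labels, length) over the cycles of `σ`, fixed points
included. -/
def orbitData {α : Type*} [Fintype α] (σ : Perm α) (ε : α → ℤˣ) : Multiset (ℤˣ × ℕ) :=
  ∑ q : Quotient (Perm.SameCycle.setoid σ),
    {(∏ x with Quotient.mk _ x = q, ε x, (Finset.univ.filter fun x => Quotient.mk _ x = q).card)}

/-- Any convenient index set for the cycles may replace the quotient; all later computations of
`orbitData` rest on this freedom. -/
lemma orbitData_eq {α ι : Type*} [Fintype α] [Fintype ι] [DecidableEq ι] {σ : Perm α}
    (ε : α → ℤˣ) {p : α → ι} (hp : Function.Surjective p)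
    (h : ∀ x y, p x = p y ↔ σ.SameCycle x y) :
    orbitData σ ε = ∑ i, {(∏ x with p x = i, ε x, (Finset.univ.filter fun x => p x = i).card)} := by
  classical
  let q : Quotient (Perm.SameCycle.setoid σ) → ι := Quotient.lift p fun x y hxy => (h x y).2 hxy
  have hq : Function.Bijective q := by
    refine ⟨fun a b => ?_, fun i => ?_⟩
    · induction a using Quotient.inductionOn
      induction b using Quotient.inductionOn
      exact fun hab => Quotient.sound ((h _ _).1 hab)
    · obtain ⟨x, rfl⟩ := hp i
      exact ⟨Quotient.mk _ x, rfl⟩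
  refine Fintype.sum_bijective q hq _ _ fun a => ?_
  have : ∀ x, (Quotient.mk _ x = a) = (p x = q a) := fun x => propext (hq.1.eq_iff (a := ⟦x⟧)).symm
  simp only [this]

lemma sameCycle_iff_exists_pow {α : Type*} [Finite α] {σ : Perm α} {x y : α} :
    σ.SameCycle x y ↔ ∃ n : ℕ, (σ ^ n) x = y := by
  refine ⟨fun h => ?_, fun ⟨n, hn⟩ => ⟨n, by simpa using hn⟩⟩
  obtain ⟨n, -, -, hn⟩ := h.exists_pow_eq''
  exact ⟨n, hn⟩

lemma pow_apply_of_semiconj {α β : Type*} {σ : Perm α} {τ : Perm β} {e : α → β}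
    (h : ∀ x, e (σ x) = τ (e x)) (n : ℕ) (x : α) : e ((σ ^ n) x) = (τ ^ n) (e x) := by
  rw [Perm.coe_pow, Perm.coe_pow]
  exact Function.Semiconj.iterate_right (f := e) h n x

lemma sameCycle_of_semiconj {α β : Type*} [Finite α] [Finite β] {σ : Perm α} {τ : Perm β}
    {e : α → β} (he : Function.Injective e) (h : ∀ x, e (σ x) = τ (e x)) {x y : α} :
    τ.SameCycle (e x) (e y) ↔ σ.SameCycle x y := by
  simp only [sameCycle_iff_exists_pow, ← pow_apply_of_semiconj h, he.eq_iff]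

lemma orbitData_equiv {α β : Type*} [Fintype α] [Fintype β] {σ : Perm α} {τ : Perm β} (e : α ≃ β)
    (h : ∀ x, e (σ x) = τ (e x)) (ε : β → ℤˣ) : orbitData σ (fun x => ε (e x)) = orbitData τ ε := by
  classical
  rw [orbitData_eq (p := fun x => (Quotient.mk (Perm.SameCycle.setoid τ) (e x))), orbitData]
  · refine Finset.sum_congr rfl fun q _ => ?_
    congr 2
    · exact Finset.prod_equiv e (by simp) (by simp)
    · exact Finset.card_equiv e (by simp)
  · exact Quotient.mk_surjective.comp e.surjective
  · intro x y
    rw [Quotient.eq]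
    exact sameCycle_of_semiconj e.injective h

lemma orbitData_sumCongr {α β : Type*} [Fintype α] [Fintype β] (σ : Perm α) (τ : Perm β)
    (ε : α ⊕ β → ℤˣ) : orbitData (Equiv.sumCongr σ τ) ε =
      orbitData σ (fun x => ε (Sum.inl x)) + orbitData τ (fun x => ε (Sum.inr x)) := by
  classical
  have hl : ∀ x : α, (Sum.inl (σ x) : α ⊕ β) = Equiv.sumCongr σ τ (Sum.inl x) := fun _ => rfl
  have hr : ∀ x : β, (Sum.inr (τ x) : α ⊕ β) = Equiv.sumCongr σ τ (Sum.inr x) := fun _ => rfl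
  rw [orbitData_eq (p := Sum.map (Quotient.mk (Perm.SameCycle.setoid σ))
    (Quotient.mk (Perm.SameCycle.setoid τ))), Fintype.sum_sum_type, orbitData, orbitData]
  · congr 1
    · refine Finset.sum_congr rfl fun q _ => ?_
      have h1 : (Finset.univ.filter fun x : α ⊕ β => Sum.map (Quotient.mk
          (Perm.SameCycle.setoid σ)) (Quotient.mk (Perm.SameCycle.setoid τ)) x = Sum.inl q) =
          (Finset.univ.filter fun x => Quotient.mk _ x = q).map Function.Embedding.inl := by
        ext x
        rcases x with x | x <;> simp
      rw [h1, Finset.prod_map, Finset.card_map]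
      rfl
    · refine Finset.sum_congr rfl fun q _ => ?_
      have h1 : (Finset.univ.filter fun x : α ⊕ β => Sum.map (Quotient.mk
          (Perm.SameCycle.setoid σ)) (Quotient.mk (Perm.SameCycle.setoid τ)) x = Sum.inr q) =
          (Finset.univ.filter fun x => Quotient.mk _ x = q).map Function.Embedding.inr := by
        ext x
        rcases x with x | x <;> simp
      rw [h1, Finset.prod_map, Finset.card_map]
      rfl
  · exact Sum.map_surjective.2 ⟨Quotient.mk_surjective, Quotient.mk_surjective⟩
  · rintro (x | x) (y | y)
    · rw [sameCycle_of_semiconj Sum.inl_injective hl, Sum.map_inl, Sum.map_inl, Sum.inl.injEq,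
        Quotient.eq]
      rfl
    · simp [sameCycle_iff_exists_pow, ← pow_apply_of_semiconj hl]
    · simp [sameCycle_iff_exists_pow, ← pow_apply_of_semiconj hr]
    · rw [sameCycle_of_semiconj Sum.inr_injective hr, Sum.map_inr, Sum.map_inr, Sum.inr.injEq,
        Quotient.eq]
      rfl

lemma orbitData_of_isEmpty {α : Type*} [Fintype α] [IsEmpty α] (σ : Perm α) (ε : α → ℤˣ) :
    orbitData σ ε = 0 := by
  rw [orbitData_eq (p := (isEmptyElim : α → Empty)) ε (fun i => i.elim) (fun x => isEmptyElim x)]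
  rfl

lemma orbitData_of_forall_sameCycle {α : Type*} [Fintype α] {σ : Perm α} (a : α)
    (h : ∀ x, σ.SameCycle a x) (ε : α → ℤˣ) :
    orbitData σ ε = {(∏ x, ε x, Fintype.card α)} := by
  rw [orbitData_eq (p := fun _ : α => ()) ε (fun _ => ⟨a, rfl⟩)
    (fun x y => iff_of_true rfl ((h x).symm.trans (h y)))]
  simp

lemma map_snd_orbitData {α : Type*} [Fintype α] [DecidableEq α] (σ : Perm α) (ε : α → ℤˣ) :
    (orbitData σ ε).map Prod.snd = σ.partition.parts := by
  classical
  -- The partition of a permutation lists its nontrivial cycles and its fixed points separately, so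
  -- the cycles are indexed in the same way.
  let p : α → σ.cycleFactorsFinset ⊕ {x // σ x = x} := fun x =>
    if h : σ x = x then Sum.inr ⟨x, h⟩
    else Sum.inl ⟨σ.cycleOf x, Perm.cycleOf_mem_cycleFactorsFinset_iff.2 (Perm.mem_support.2 h)⟩
  have hr : ∀ x y, p x = Sum.inr y ↔ x = y := by
    intro x y
    by_cases h : σ x = x
    · simp [p, h, Subtype.ext_iff]
    · simp only [p, h, dite_false, reduceCtorEq, false_iff]
      rintro rfl
      exact h y.2
  have hl : ∀ x c, p x = Sum.inl c ↔ x ∈ (c : Perm α).support := by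
    rintro x ⟨c, hc⟩
    by_cases h : σ x = x
    · simp only [p, h, dite_true, reduceCtorEq, false_iff]
      exact fun hx => Perm.mem_support.1 (Perm.mem_cycleFactorsFinset_support_le hc hx) h
    · simp only [p, h, dite_false, Sum.inl.injEq, Subtype.mk.injEq]
      refine ⟨?_, fun hx => (Perm.cycle_is_cycleOf hx hc).symm⟩
      rintro rfl
      exact Perm.mem_support_cycleOf_iff.2 ⟨Perm.SameCycle.refl _ _, Perm.mem_support.2 h⟩
  rw [orbitData_eq (p := p), ← Multiset.coe_mapAddMonoidHom, map_sum, Fintype.sum_sum_type,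
    Perm.parts_partition]
  · simp only [hl, hr, Multiset.coe_mapAddMonoidHom, Multiset.map_singleton]
    congr 1
    · rw [Perm.cycleType_def, Finset.sum_coe_sort σ.cycleFactorsFinset (fun c => ({(Finset.univ.filter
        fun x => x ∈ c.support).card} : Multiset ℕ)), ← Multiset.sum_map_singleton (Multiset.map _ _),
        Multiset.map_map]
      simp [Function.comp_def, -Perm.mem_support]
    · have h1 : (Finset.univ.filter fun x => σ x = x) = σ.supportᶜ := by
        ext x
        simp
      simp [Finset.filter_eq', Multiset.nsmul_singleton, Fintype.card_subtype, h1,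
        Finset.card_compl]
  · rintro (c | y)
    · obtain ⟨x, hx⟩ := (Perm.mem_cycleFactorsFinset_iff.1 c.2).1.nonempty_support
      exact ⟨x, (hl _ _).2 hx⟩
    · exact ⟨y, (hr _ _).2 rfl⟩
  · intro x y
    by_cases h : σ y = y
    · have : p y = Sum.inr ⟨y, h⟩ := (hr _ _).2 rfl
      rw [this, hr]
      exact ⟨fun h => h ▸ Perm.SameCycle.refl _ _, fun hxy => (hxy.symm.eq_of_left h).symm⟩
    · have : p y = Sum.inl ⟨σ.cycleOf y,
          Perm.cycleOf_mem_cycleFactorsFinset_iff.2 (Perm.mem_support.2 h)⟩ := by simp [p, h]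
      rw [this, hl, Perm.mem_support_cycleOf_iff]
      exact ⟨fun h => h.1.symm, fun h' => ⟨h'.symm, Perm.mem_support.2 h⟩⟩

/-! ### Extension of a permutation by local data -/

/-- The composition of local data along a path. -/
def localMul (x y : Perm (Fin 3) × (Fin 3 → ℤˣ)) : Perm (Fin 3) × (Fin 3 → ℤˣ) :=
  (x.1 * y.1, fun j => y.2 j * x.2 (y.1 j))

lemma localMul_assoc (x y z : Perm (Fin 3) × (Fin 3 → ℤˣ)) :
    localMul (localMul x y) z = localMul x (localMul y z) := by
  simp [localMul, mul_assoc]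

lemma localMul_mem {c d : ℤˣ} {x y : Perm (Fin 3) × (Fin 3 → ℤˣ)} (hx : x ∈ localSet c)
    (hy : y ∈ localSet d) : localMul x y ∈ localSet (c * d) := by
  rw [mem_localSet] at *
  refine ⟨by simp [localMul, hx, hy], ?_⟩
  simp only [localMul, Finset.prod_mul_distrib]
  rw [Equiv.prod_comp y.1 x.2, hx.2, hy.2, mul_comm]

lemma localMul_left_injective (y : Perm (Fin 3) × (Fin 3 → ℤˣ)) :
    Function.Injective fun x => localMul x y := by
  intro x x' h
  have h1 : x.1 = x'.1 := mul_right_cancel (congrArg Prod.fst h)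
  refine Prod.ext h1 (funext fun j => ?_)
  have := congrFun (congrArg Prod.snd h) (y.1⁻¹ j)
  simpa [localMul] using this

/-- Right multiplication by `localSet 1` is transitive on `localSet c`; this is the source of
uniformity in `map_pathData`. -/
lemma exists_localMul_eq {c : ℤˣ} {x y : Perm (Fin 3) × (Fin 3 → ℤˣ)} (hx : x ∈ localSet c)
    (hy : y ∈ localSet c) : ∃ u ∈ localSet 1, localMul x u = y := by
  rw [mem_localSet] at hx hy
  refine ⟨(x.1⁻¹ * y.1, fun j => y.2 j * x.2 ((x.1⁻¹ * y.1) j)), ?_, ?_⟩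
  · rw [mem_localSet]
    refine ⟨by simp [hx, hy], ?_⟩
    simp only [Finset.prod_mul_distrib]
    rw [Equiv.prod_comp (x.1⁻¹ * y.1) x.2, hx.2, hy.2, Int.units_mul_self]
  · refine Prod.ext (by simp [localMul]) (funext fun j => ?_)
    simp [localMul, mul_assoc]

/-- The permutation of `α × Fin 3` extending `σ` by local data. -/
def localExt {α : Type*} (σ : Perm α) (f : α → Perm (Fin 3) × (Fin 3 → ℤˣ)) :
    Perm (α × Fin 3) where
  toFun v := (σ v.1, (f v.1).1 v.2)
  invFun v := (σ⁻¹ v.1, (f (σ⁻¹ v.1)).1⁻¹ v.2)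
  left_inv v := by simp
  right_inv v := by simp

/-- The labels of the extension of a permutation by local data. -/
def localLabel {α : Type*} (f : α → Perm (Fin 3) × (Fin 3 → ℤˣ)) (v : α × Fin 3) : ℤˣ :=
  (f v.1).2 v.2

/-- The composition of the local data along the path `a, σ a, …, σ ^ (m - 1) a`. -/
def pathData {α : Type*} (σ : Perm α) (f : α → Perm (Fin 3) × (Fin 3 → ℤˣ)) (a : α) :
    ℕ → Perm (Fin 3) × (Fin 3 → ℤˣ)
  | 0 => (1, fun _ => 1)
  | m + 1 => localMul (f ((σ ^ m) a)) (pathData σ f a m)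

lemma localExt_pow {α : Type*} (σ : Perm α) (f : α → Perm (Fin 3) × (Fin 3 → ℤˣ)) (a : α)
    (j : Fin 3) (m : ℕ) :
    (localExt σ f ^ m) (a, j) = ((σ ^ m) a, (pathData σ f a m).1 j) := by
  induction m with
  | zero => rfl
  | succ m ih =>
    rw [pow_succ', Perm.mul_apply, ih, pow_succ', Perm.mul_apply]
    rfl

lemma pathData_snd {α : Type*} (σ : Perm α) (f : α → Perm (Fin 3) × (Fin 3 → ℤˣ)) (a : α)
    (j : Fin 3) (m : ℕ) : (pathData σ f a m).2 j =
      ∏ i : Fin m, localLabel f ((localExt σ f ^ (i : ℕ)) (a, j)) := by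
  induction m with
  | zero => rfl
  | succ m ih =>
    rw [Fin.prod_univ_castSucc, pathData]
    change (pathData σ f a m).2 j * _ = _
    rw [ih]
    simp [localLabel, localExt_pow]

/-- Multiplication of the sizes by `k`. -/
def scale (k : ℕ) (p : ℤˣ × ℕ) : ℤˣ × ℕ := (p.1, k * p.2)

/-! ### Extensions over a single cycle. -/

section Transitive

variable {α : Type*} [Fintype α] {σ : Perm α} {a : α}

lemma isCycleOn_of_forall_sameCycle (h : ∀ x, σ.SameCycle a x) :
    σ.IsCycleOn ((Finset.univ : Finset α) : Set α) := by
  refine ⟨by simp, fun x _ y _ => (h x).symm.trans (h y)⟩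

lemma pow_apply_eq_iff (h : ∀ x, σ.SameCycle a x) (m : ℕ) :
    (σ ^ m) a = a ↔ Fintype.card α ∣ m :=
  (isCycleOn_of_forall_sameCycle h).pow_apply_eq (Finset.mem_univ a)

lemma bijective_pow_apply (h : ∀ x, σ.SameCycle a x) :
    Function.Bijective fun i : Fin (Fintype.card α) => (σ ^ (i : ℕ)) a := by
  rw [Fintype.bijective_iff_surjective_and_card]
  refine ⟨fun x => ?_, by simp⟩
  obtain ⟨m, hm, hx⟩ := (isCycleOn_of_forall_sameCycle h).exists_pow_eq (Finset.mem_univ a)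
    (Finset.mem_univ x)
  exact ⟨⟨m, hm⟩, hx⟩

lemma bijective_localExt_pow (h : ∀ x, σ.SameCycle a x)
    (f : α → Perm (Fin 3) × (Fin 3 → ℤˣ)) :
    Function.Bijective fun v : Fin (Fintype.card α) × Fin 3 =>
      (localExt σ f ^ (v.1 : ℕ)) (a, v.2) := by
  rw [Fintype.bijective_iff_injective_and_card]
  refine ⟨?_, by simp⟩
  rintro ⟨i, j⟩ ⟨i', j'⟩ hv
  simp only [localExt_pow, Prod.mk.injEq] at hv
  obtain rfl := (bijective_pow_apply h).1 hv.1
  simpa using hv.2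

/-- The fibre above `a` is revisited exactly at multiples of the cycle length, and the first return
map is the permutation part of the full path. -/
lemma sameCycle_localExt (h : ∀ x, σ.SameCycle a x) (f : α → Perm (Fin 3) × (Fin 3 → ℤˣ))
    (j j' : Fin 3) : (localExt σ f).SameCycle (a, j) (a, j') ↔
      (pathData σ f a (Fintype.card α)).1.SameCycle j j' := by
  have key : ∀ q : ℕ, (localExt σ f ^ (Fintype.card α * q)) (a, j) =
      (a, ((pathData σ f a (Fintype.card α)).1 ^ q) j) := by
    intro q
    rw [pow_mul]
    induction q with
    | zero => rfl
    | succ q ih =>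
      rw [pow_succ', Perm.mul_apply, ih, localExt_pow, (pow_apply_eq_iff h _).2 dvd_rfl, pow_succ',
        Perm.mul_apply]
  rw [sameCycle_iff_exists_pow, sameCycle_iff_exists_pow]
  constructor
  · rintro ⟨m, hm⟩
    have h1 := hm
    rw [localExt_pow, Prod.mk.injEq, pow_apply_eq_iff h] at h1
    obtain ⟨q, rfl⟩ := h1.1
    rw [key] at hm
    exact ⟨q, congrArg Prod.snd hm⟩
  · rintro ⟨q, hq⟩
    exact ⟨_, (key q).trans (by rw [hq])⟩

/-- Each point is reached from exactly one point of the fibre above `a` in fewer than `k` steps.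
Hence each cycle of the first return map is stretched by the factor `k`, and its label collects all
labels met between returns. -/
lemma orbitData_localExt (h : ∀ x, σ.SameCycle a x) (f : α → Perm (Fin 3) × (Fin 3 → ℤˣ)) :
    orbitData (localExt σ f) (localLabel f) =
      (orbitData (pathData σ f a (Fintype.card α)).1 (pathData σ f a (Fintype.card α)).2).map
        (scale (Fintype.card α)) := by
  classical
  set k := Fintype.card α
  set π := (pathData σ f a k).1 with hπ
  let Φ : Fin k × Fin 3 ≃ α × Fin 3 := Equiv.ofBijective _ (bijective_localExt_pow h f)
  have hΦ : ∀ v, Φ v = (localExt σ f ^ (v.1 : ℕ)) (a, v.2) := fun _ => rfl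
  rw [orbitData_eq (p := fun v => Quotient.mk (Perm.SameCycle.setoid π) (Φ.symm v).2), orbitData,
    ← Multiset.coe_mapAddMonoidHom, map_sum]
  · refine Finset.sum_congr rfl fun q _ => ?_
    rw [Multiset.coe_mapAddMonoidHom, Multiset.map_singleton, scale]
    have h1 : (Finset.univ.filter fun v : α × Fin 3 => Quotient.mk (Perm.SameCycle.setoid π)
        (Φ.symm v).2 = q) = ((Finset.univ : Finset (Fin k)) ×ˢ
          (Finset.univ.filter fun j => Quotient.mk _ j = q)).map Φ.toEmbedding := by
      ext v
      simp [Finset.mem_map_equiv]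
    rw [h1, Finset.prod_map, Finset.card_map, Finset.card_product, Finset.prod_product_right]
    simp only [Finset.card_univ, Fintype.card_fin]
    congr 2
    refine Finset.prod_congr rfl fun j _ => ?_
    rw [pathData_snd]
    rfl
  · refine Quotient.mk_surjective.comp (Function.Surjective.comp ?_ Φ.symm.surjective)
    exact fun j => ⟨(⟨0, Fintype.card_pos_iff.2 ⟨a⟩⟩, j), rfl⟩
  · intro x y
    obtain ⟨v, rfl⟩ := Φ.surjective x
    obtain ⟨w, rfl⟩ := Φ.surjective y
    rw [Φ.symm_apply_apply, Φ.symm_apply_apply, hΦ, hΦ, Perm.sameCycle_pow_left,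
      Perm.sameCycle_pow_right, sameCycle_localExt h, Quotient.eq]
    rfl

end Transitive

/-! ## Uniform distributions -/

/-- Fibres of equal size push a uniform law to a uniform law. The inequality is assumed for all
ordered pairs, so an injection from any fibre into any other is enough. -/
lemma map_uniformOfFinset {α β : Type*} [DecidableEq β] {X : Finset α} (hX : X.Nonempty)
    {Y : Finset β} (hY : Y.Nonempty) {f : α → β} (hf : ∀ x ∈ X, f x ∈ Y)
    (h : ∀ y ∈ Y, ∀ y' ∈ Y, (X.filter fun x => f x = y).card ≤ (X.filter fun x => f x = y').card) :
    (PMF.uniformOfFinset X hX).map f = PMF.uniformOfFinset Y hY := by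
  classical
  ext y
  rw [← PMF.toOuterMeasure_apply_singleton, PMF.toOuterMeasure_map_apply,
    PMF.toOuterMeasure_uniformOfFinset_apply, PMF.uniformOfFinset_apply]
  simp only [Set.mem_preimage, Set.mem_singleton_iff]
  split_ifs with hy
  · have h1 : X.card = Y.card * (X.filter fun x => f x = y).card := by
      rw [Finset.card_eq_sum_card_fiberwise (f := f) (t := Y) hf]
      exact Finset.sum_const_nat fun y' hy' => le_antisymm (h _ hy' _ hy) (h _ hy _ hy')
    have h2 : (X.filter fun x => f x = y).card ≠ 0 := fun h0 =>
      hX.card_pos.ne' (by rw [h1, h0, mul_zero])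
    rw [h1, Nat.cast_mul, ENNReal.div_eq_inv_mul, ENNReal.mul_inv (by simp) (by simp), mul_assoc,
      ENNReal.inv_mul_cancel (by simpa using h2) (by simp), mul_one]
  · rw [Finset.filter_false_of_mem fun x hx (h : f x = y) => hy (h ▸ hf x hx)]
    simp

lemma map_uniformOfFinset_of_bijOn {α β : Type*} {X : Finset α} (hX : X.Nonempty)
    {Y : Finset β} (hY : Y.Nonempty) {f : α → β} (hf : Set.BijOn f X Y) :
    (PMF.uniformOfFinset X hX).map f = PMF.uniformOfFinset Y hY := by
  classical
  refine map_uniformOfFinset hX hY hf.mapsTo fun y _ y' hy' => ?_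
  obtain ⟨x', hx', rfl⟩ := hf.surjOn hy'
  refine (Finset.card_le_one.2 ?_).trans (Finset.card_pos.2 ⟨x', by simpa using hx'⟩)
  intro a ha b hb
  rw [Finset.mem_filter] at ha hb
  exact hf.injOn ha.1 hb.1 (ha.2.trans hb.2.symm)

lemma bind_uniformOfFinset {α β γ : Type*} {X : Finset α} (hX : X.Nonempty) {F : α → Finset β}
    (hF : ∀ x, (F x).Nonempty) {N : ℕ} (hN : ∀ x ∈ X, (F x).card = N) {Z : Finset γ}
    (hZ : Z.Nonempty) {r : α → β → γ}
    (hr : ∀ x ∈ X, ∀ x' ∈ X, ∀ b ∈ F x, ∀ b' ∈ F x', r x b = r x' b' → x = x' ∧ b = b')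
    (hmem : ∀ z, z ∈ Z ↔ ∃ x ∈ X, ∃ b ∈ F x, z = r x b) :
    PMF.uniformOfFinset Z hZ = (PMF.uniformOfFinset X hX).bind fun x =>
      (PMF.uniformOfFinset (F x) (hF x)).map (r x) := by
  classical
  have hcard : Z.card = X.card * N := by
    have : Z = (X.sigma F).image fun p => r p.1 p.2 := by
      ext z
      simp only [hmem, Finset.mem_image, Finset.mem_sigma, Sigma.exists]
      constructor
      · rintro ⟨x, hx, b, hb, rfl⟩
        exact ⟨x, b, ⟨hx, hb⟩, rfl⟩
      · rintro ⟨x, b, ⟨hx, hb⟩, rfl⟩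
        exact ⟨x, hx, b, hb, rfl⟩
    rw [this, Finset.card_image_of_injOn, Finset.card_sigma, Finset.sum_const_nat hN]
    rintro ⟨x, b⟩ hx ⟨x', b'⟩ hx' h
    simp only [Finset.coe_sigma, Set.mem_sigma_iff, Finset.mem_coe] at hx hx'
    obtain ⟨rfl, rfl⟩ := hr x hx.1 x' hx'.1 b hx.2 b' hx'.2 h
    rfl
  ext z
  rw [PMF.bind_apply, PMF.uniformOfFinset_apply]
  split_ifs with hz
  · obtain ⟨x, hx, b, hb, rfl⟩ := (hmem z).1 hz
    have key : ∀ x', x' ∈ X → ((PMF.uniformOfFinset (F x') (hF x')).map (r x')) (r x b) =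
        if x' = x then (N : ℝ≥0∞)⁻¹ else 0 := by
      intro x' hx'
      rw [← PMF.toOuterMeasure_apply_singleton, PMF.toOuterMeasure_map_apply,
        PMF.toOuterMeasure_uniformOfFinset_apply]
      simp only [Set.mem_preimage, Set.mem_singleton_iff]
      split_ifs with h
      · subst h
        have : ((F x').filter fun b' => r x' b' = r x' b) = {b} := by
          ext b'
          simp only [Finset.mem_filter, Finset.mem_singleton]
          refine ⟨fun h => (hr _ hx _ hx _ h.1 _ hb h.2).2, ?_⟩
          rintro rfl
          exact ⟨hb, rfl⟩
        rw [this, hN _ hx, Finset.card_singleton, Nat.cast_one, one_div]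
      · rw [Finset.filter_false_of_mem fun b' hb' h' => h (hr _ hx' _ hx _ hb' _ hb h').1]
        simp
    rw [tsum_eq_single x, key x hx, if_pos rfl, PMF.uniformOfFinset_apply_of_mem _ hx, hcard,
      Nat.cast_mul, ENNReal.mul_inv (by simp) (by simp)]
    intro x' hne
    by_cases hx' : x' ∈ X
    · rw [key x' hx', if_neg hne, mul_zero]
    · rw [PMF.uniformOfFinset_apply_of_notMem _ hx', zero_mul]
  · symm
    rw [ENNReal.tsum_eq_zero]
    intro x
    by_cases hx : x ∈ X
    · rw [mul_eq_zero]
      right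
      rw [PMF.apply_eq_zero_iff, PMF.support_map]
      rintro ⟨b, hb, rfl⟩
      rw [PMF.support_uniformOfFinset] at hb
      exact hz ((hmem _).2 ⟨x, hx, b, hb, rfl⟩)
    · rw [PMF.uniformOfFinset_apply_of_notMem _ hx, zero_mul]

/-! ## The Markov process on multisets -/

/-- The transition of the Markov process, on multisets of typed parts. -/
def stepMultiset (m : Multiset (Label × ℕ)) : PMF (Multiset (Label × ℕ)) :=
  (stepSeq m.toList).map (↑)

/-- The sum of independent random multisets. -/
def addDist (p q : PMF (Multiset (Label × ℕ))) : PMF (Multiset (Label × ℕ)) :=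
  p.bind fun a => q.map fun b => a + b

lemma addDist_comm (p q : PMF (Multiset (Label × ℕ))) : addDist p q = addDist q p := by
  unfold addDist
  simp only [PMF.map, Function.comp_def]
  rw [PMF.bind_comm]
  simp only [add_comm]

lemma addDist_assoc (p q r : PMF (Multiset (Label × ℕ))) :
    addDist (addDist p q) r = addDist p (addDist q r) := by
  unfold addDist
  simp [PMF.map, Function.comp_def, PMF.bind_bind, add_assoc]

lemma addDist_pure_zero (p : PMF (Multiset (Label × ℕ))) : addDist p (PMF.pure 0) = p := by
  unfold addDist
  simp [PMF.map, Function.comp_def]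

lemma map_stepSeq_cons (p : Label × ℕ) (l : TypeSeq) :
    (stepSeq (p :: l)).map ((↑) : TypeSeq → Multiset (Label × ℕ)) =
      addDist ((stepPart p).map (↑)) ((stepSeq l).map (↑)) := by
  unfold addDist
  simp [stepSeq, PMF.map, Function.comp_def, PMF.bind_bind]

/-- Independent parts may be reordered. This makes `stepMultiset` independent of the list chosen to
represent a multiset. -/
lemma map_stepSeq_perm {l l' : TypeSeq} (h : l.Perm l') :
    (stepSeq l).map ((↑) : TypeSeq → Multiset (Label × ℕ)) = (stepSeq l').map (↑) := by
  induction h with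
  | nil => rfl
  | cons x _ ih => rw [map_stepSeq_cons, map_stepSeq_cons, ih]
  | swap x y l =>
    rw [map_stepSeq_cons, map_stepSeq_cons, map_stepSeq_cons, map_stepSeq_cons, ← addDist_assoc,
      ← addDist_assoc, addDist_comm ((stepPart y).map _)]
  | trans _ _ h1 h2 => exact h1.trans h2

lemma stepMultiset_coe (l : TypeSeq) : stepMultiset l = (stepSeq l).map (↑) :=
  map_stepSeq_perm (Multiset.coe_eq_coe.1 (Multiset.coe_toList _))

lemma stepMultiset_zero : stepMultiset 0 = PMF.pure 0 := by
  rw [← Multiset.coe_nil, stepMultiset_coe, stepSeq, PMF.pure_map]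

lemma stepMultiset_singleton (p : Label × ℕ) : stepMultiset {p} = (stepPart p).map (↑) := by
  rw [← Multiset.coe_singleton, stepMultiset_coe, map_stepSeq_cons, stepSeq, PMF.pure_map]
  exact addDist_pure_zero _

lemma stepMultiset_add (m m' : Multiset (Label × ℕ)) :
    stepMultiset (m + m') = addDist (stepMultiset m) (stepMultiset m') := by
  induction m using Quotient.inductionOn with | _ l
  induction m' using Quotient.inductionOn with | _ l'
  change stepMultiset ((l : Multiset _) + (l' : Multiset _)) =
    addDist (stepMultiset (l : Multiset _)) (stepMultiset (l' : Multiset _))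
  rw [Multiset.coe_add]
  simp only [stepMultiset_coe]
  induction l with
  | nil => rw [List.nil_append, stepSeq, PMF.pure_map, addDist_comm]; exact (addDist_pure_zero _).symm
  | cons p l ih => rw [List.cons_append, map_stepSeq_cons, map_stepSeq_cons, ih, addDist_assoc]

lemma map_coe_markov_succ (init : PMF TypeSeq) (n : ℕ) :
    (markov init (n + 1)).map ((↑) : TypeSeq → Multiset (Label × ℕ)) =
      ((markov init n).map (↑)).bind stepMultiset := by
  rw [markov, PMF.map_bind, PMF.bind_map]
  simp only [Function.comp_def, stepMultiset_coe]

/-! ## Local distributions -/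

/-- The triples of signs with product `c`. -/
def signTriples (c : ℤˣ) : Finset (Fin 3 → ℤˣ) := Finset.univ.filter fun e => ∏ j, e j = c

lemma signTriples_nonempty (c : ℤˣ) : (signTriples c).Nonempty :=
  ⟨![c, 1, 1], by simp [signTriples, Fin.prod_univ_three]⟩

lemma localSet_nonempty (c : ℤˣ) : (localSet c).Nonempty := by
  revert c; decide

lemma card_localSet (c : ℤˣ) : (localSet c).card = 12 := by
  revert c; decide +kernel

lemma orbitData_one (e : Fin 3 → ℤˣ) : orbitData 1 e = {(e 0, 1), (e 1, 1), (e 2, 1)} := by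
  rw [orbitData_eq (p := id) e Function.surjective_id (by simp), Fin.sum_univ_three]
  simp [Finset.filter_eq']

lemma orbitData_three {π : Perm (Fin 3)} (h : Perm.sign π = 1) (h1 : π ≠ 1) (e : Fin 3 → ℤˣ) :
    orbitData π e = {(∏ j, e j, 3)} := by
  refine orbitData_of_forall_sameCycle 0 ?_ e
  revert π
  decide

/-- The fixed point of a transposition, and the two other points. -/
def transpositionPoints (π : Perm (Fin 3)) : Fin 3 × Fin 3 × Fin 3 :=
  if π 0 = 0 then (1, 2, 0) else if π 1 = 1 then (0, 2, 1) else (0, 1, 2)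

/-- The products of a triple of signs over the two cycles of a transposition. -/
def transpositionPair (π : Perm (Fin 3)) (e : Fin 3 → ℤˣ) : ℤˣ × ℤˣ :=
  (e (transpositionPoints π).1 * e (transpositionPoints π).2.1, e (transpositionPoints π).2.2)

lemma orbitData_transposition {π : Perm (Fin 3)} (h : Perm.sign π = -1) (e : Fin 3 → ℤˣ) :
    orbitData π e = {((transpositionPair π e).1, 2), ((transpositionPair π e).2, 1)} := by
  have h1 : Function.Surjective fun j => decide (j ≠ (transpositionPoints π).2.2) := by
    revert π; decide
  have h2 : ∀ x y, decide (x ≠ (transpositionPoints π).2.2) =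
      decide (y ≠ (transpositionPoints π).2.2) ↔ π.SameCycle x y := by
    revert π; decide
  have h3 : ∏ x with decide (x ≠ (transpositionPoints π).2.2) = true, e x =
      (transpositionPair π e).1 ∧ ∏ x with decide (x ≠ (transpositionPoints π).2.2) = false, e x =
      (transpositionPair π e).2 := by
    clear h1 h2
    revert π e; decide +kernel
  have h4 : (Finset.univ.filter fun x => decide (x ≠ (transpositionPoints π).2.2) = true).card = 2 ∧
      (Finset.univ.filter fun x => decide (x ≠ (transpositionPoints π).2.2) = false).card = 1 := by
    clear h1 h2 h3
    revert π; decide +kernel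
  rw [orbitData_eq (p := fun j => decide (j ≠ (transpositionPoints π).2.2)) e h1 h2,
    Fintype.sum_bool, h3.1, h3.2, h4.1, h4.2]
  rfl

lemma bind_uniformOfFinset_congr {α β : Type*} {X : Finset α} (hX : X.Nonempty) {p q : α → PMF β}
    (h : ∀ x ∈ X, p x = q x) :
    (PMF.uniformOfFinset X hX).bind p = (PMF.uniformOfFinset X hX).bind q := by
  ext b
  rw [PMF.bind_apply, PMF.bind_apply]
  refine tsum_congr fun x => ?_
  by_cases hx : x ∈ X
  · rw [h x hx]
  · rw [PMF.uniformOfFinset_apply_of_notMem _ hx, zero_mul, zero_mul]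

lemma map_uniformOfFinset_congr {α β : Type*} {X : Finset α} (hX : X.Nonempty) {f g : α → β}
    (h : ∀ x ∈ X, f x = g x) :
    (PMF.uniformOfFinset X hX).map f = (PMF.uniformOfFinset X hX).map g :=
  bind_uniformOfFinset_congr hX fun x hx => congrArg PMF.pure (h x hx)

lemma map_uniformOfFinset_eq_ofFintype {α ι : Type*} [Fintype ι] [DecidableEq ι] {X : Finset α}
    (hX : X.Nonempty) {κ : α → ι} {w : ι → ℝ≥0} (hw : ∑ i, (w i : ℝ≥0∞) = 1)
    (h : ∀ i, w i = (X.filter fun x => κ x = i).card / X.card) :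
    (PMF.uniformOfFinset X hX).map κ = PMF.ofFintype (fun i => (w i : ℝ≥0∞)) hw := by
  classical
  ext i
  rw [← PMF.toOuterMeasure_apply_singleton, PMF.toOuterMeasure_map_apply,
    PMF.toOuterMeasure_uniformOfFinset_apply, PMF.ofFintype_apply, h i,
    ENNReal.coe_div (by simpa using hX.ne_empty)]
  simp

/-- The permutations of sign `c`. -/
def signPerms (c : ℤˣ) : Finset (Perm (Fin 3)) := Finset.univ.filter fun π => Perm.sign π = c

lemma signPerms_nonempty (c : ℤˣ) : (signPerms c).Nonempty := by
  revert c; decide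

lemma uniform_localSet (c : ℤˣ) : PMF.uniformOfFinset (localSet c) (localSet_nonempty c) =
    (PMF.uniformOfFinset (signPerms c) (signPerms_nonempty c)).bind fun π =>
      (PMF.uniformOfFinset (signTriples c) (signTriples_nonempty c)).map (Prod.mk π) := by
  refine bind_uniformOfFinset (N := (signTriples c).card) _ _ (fun _ _ => rfl) _ ?_ ?_
  · intro x _ x' _ b _ b' _ h
    exact Prod.mk.inj h
  · rintro ⟨π, e⟩
    simp [mem_localSet, signPerms, signTriples]

lemma map_uniform_signTriples (c : ℤˣ) :
    (PMF.uniformOfFinset (signTriples c) (signTriples_nonempty c)).map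
      (fun e => (e 0, e 1, e 2)) = uniformTriples c := by
  refine map_uniformOfFinset _ _ ?_ ?_ <;> revert c <;> decide +kernel

lemma map_transpositionPair {π : Perm (Fin 3)} (h : Perm.sign π = -1) (c : ℤˣ) :
    (PMF.uniformOfFinset (signTriples c) (signTriples_nonempty c)).map (transpositionPair π) =
      uniformPairs c := by
  refine map_uniformOfFinset _ _ ?_ ?_ <;> revert c π <;> decide +kernel

lemma map_uniform_signPerms_one :
    (PMF.uniformOfFinset (signPerms 1) (signPerms_nonempty 1)).map (fun π => decide (π ≠ 1)) =
      twoThirds := by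
  refine map_uniformOfFinset_eq_ofFintype _ _ ?_
  have h1 : (signPerms 1).card = 3 := by decide
  have h2 : ((signPerms 1).filter fun π => decide (π ≠ 1) = true).card = 2 := by decide
  have h3 : ((signPerms 1).filter fun π => decide (π ≠ 1) = false).card = 1 := by decide
  rintro (_ | _)
  · rw [h1, h3]; simp
  · rw [h1, h2]; simp

/-- For sign `1`, two of the three permutations are 3-cycles, whose single cycle has label `1`, and
the identity leaves a uniform triple of signs. For sign `-1`, every transposition turns the uniform
triple into a uniform pair of product `-1`. -/
lemma map_uniform_localSet (c : ℤˣ) (k : ℕ) :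
    (PMF.uniformOfFinset (localSet c) (localSet_nonempty c)).map
      (fun y => (orbitData y.1 y.2).map (scale k)) = stepMultiset {(c, k)} := by
  rw [stepMultiset_singleton, uniform_localSet, PMF.map_bind]
  simp only [PMF.map_comp]
  rcases Int.units_eq_one_or c with rfl | rfl
  · rw [stepPart, if_pos rfl, ← map_uniform_signPerms_one, PMF.bind_map, PMF.map_bind]
    refine bind_uniformOfFinset_congr _ fun π hπ => ?_
    have hπ : Perm.sign π = 1 := by simpa [signPerms] using hπ
    by_cases h : π = 1
    · subst h
      simp only [Function.comp_apply, ne_eq, not_true_eq_false, decide_false, Bool.false_eq_true,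
        if_false]
      rw [← map_uniform_signTriples, PMF.map_comp, PMF.map_comp]
      congr 1
      ext1 e
      simp [orbitData_one, scale]
      rfl
    · simp only [Function.comp_apply, ne_eq, h, not_false_eq_true, decide_true, if_true]
      -- The outcome of a 3-cycle depends on the signs only through their product, so the point mass
      -- is rewritten as a constant function of the triple.
      rw [PMF.pure_map, ← PMF.map_const (PMF.uniformOfFinset _ (signTriples_nonempty 1))]
      refine map_uniformOfFinset_congr _ fun e he => ?_
      have he : ∏ j, e j = 1 := by simpa [signTriples] using he
      simp [orbitData_three hπ h, scale, he, mul_comm]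
  · rw [stepPart, if_neg (show (-1 : ℤˣ) ≠ 1 by decide)]
    rw [← PMF.bind_const (PMF.uniformOfFinset _ (signPerms_nonempty (-1)))
      (PMF.map _ (PMF.map _ _))]
    refine bind_uniformOfFinset_congr _ fun π hπ => ?_
    have hπ : Perm.sign π = -1 := by simpa [signPerms] using hπ
    rw [← map_transpositionPair hπ, PMF.map_comp, PMF.map_comp]
    congr 1
    ext1 e
    simp [orbitData_transposition hπ, scale, mul_comm]
    rfl

/-! ## The distribution of the cycle data of a random extension -/

open Classical in
/-- The families of local data compatible with the signs `ε`. -/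
def localChoices {α : Type} [Fintype α] (ε : α → ℤˣ) :
    Finset (α → Perm (Fin 3) × (Fin 3 → ℤˣ)) :=
  Fintype.piFinset fun x => localSet (ε x)

lemma mem_localChoices {α : Type} [Fintype α] {ε : α → ℤˣ}
    {f : α → Perm (Fin 3) × (Fin 3 → ℤˣ)} :
    f ∈ localChoices ε ↔ ∀ x, f x ∈ localSet (ε x) := by
  simp [localChoices]

lemma localChoices_nonempty {α : Type} [Fintype α] (ε : α → ℤˣ) : (localChoices ε).Nonempty :=
  ⟨fun x => (localSet_nonempty (ε x)).choose,
    mem_localChoices.2 fun x => (localSet_nonempty (ε x)).choose_spec⟩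

lemma card_localChoices {α : Type} [Fintype α] (ε : α → ℤˣ) :
    (localChoices ε).card = 12 ^ Fintype.card α := by
  simp [localChoices, card_localSet]

/-! ### Random extensions over a single cycle. -/

section Transitive

variable {α : Type} [Fintype α] {σ : Perm α} {a : α}

lemma pathData_mem {ε : α → ℤˣ} {f : α → Perm (Fin 3) × (Fin 3 → ℤˣ)} (hf : f ∈ localChoices ε)
    (a : α) (m : ℕ) : pathData σ f a m ∈ localSet (∏ i : Fin m, ε ((σ ^ (i : ℕ)) a)) := by
  induction m with
  | zero => exact mem_localSet.2 (by simp [pathData])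
  | succ m ih =>
    rw [Fin.prod_univ_castSucc, mul_comm]
    exact localMul_mem (mem_localChoices.1 hf _) ih

/-- The path meets `a` only once, at its start, which is the rightmost factor of the composite. -/
lemma pathData_update [DecidableEq α] (h : ∀ x, σ.SameCycle a x)
    (f : α → Perm (Fin 3) × (Fin 3 → ℤˣ)) (u : Perm (Fin 3) × (Fin 3 → ℤˣ)) :
    ∀ m, m < Fintype.card α → pathData σ (Function.update f a (localMul (f a) u)) a (m + 1) =
      localMul (pathData σ f a (m + 1)) u
  | 0, _ => by
    simp only [pathData, localMul, mul_one, Perm.coe_one, id_eq, one_mul]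
    exact Function.update_self a _ f
  | m + 1, hm => by
    have hne : (σ ^ (m + 1)) a ≠ a := fun h' =>
      (Nat.le_of_dvd (Nat.succ_pos m) ((pow_apply_eq_iff h _).1 h')).not_gt hm
    rw [pathData, pathData_update h f u m (by omega), Function.update_of_ne hne, ← localMul_assoc]
    rfl

/-- Changing the datum at `a` alone multiplies the composite on the right by any prescribed element
of `localSet 1`, which gives injections between all fibres. -/
lemma map_pathData (h : ∀ x, σ.SameCycle a x) (ε : α → ℤˣ) :
    (PMF.uniformOfFinset (localChoices ε) (localChoices_nonempty ε)).map
      (fun f => pathData σ f a (Fintype.card α)) =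
      PMF.uniformOfFinset (localSet (∏ x, ε x)) (localSet_nonempty _) := by
  classical
  have hε : ∏ i : Fin (Fintype.card α), ε ((σ ^ (i : ℕ)) a) = ∏ x, ε x :=
    Fintype.prod_bijective _ (bijective_pow_apply h) _ _ fun _ => rfl
  refine map_uniformOfFinset _ _ (fun f hf => hε ▸ pathData_mem hf a _) fun y hy y' hy' => ?_
  obtain ⟨u, hu, rfl⟩ := exists_localMul_eq hy hy'
  refine Finset.card_le_card_of_injOn (fun f => Function.update f a (localMul (f a) u)) ?_ ?_
  · intro f hf
    rw [Finset.mem_coe, Finset.mem_filter] at hf ⊢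
    obtain ⟨m, hm⟩ : ∃ m, Fintype.card α = m + 1 :=
      Nat.exists_eq_succ_of_ne_zero (Fintype.card_pos_iff.2 ⟨a⟩).ne'
    refine ⟨mem_localChoices.2 fun x => ?_, ?_⟩
    · by_cases hx : x = a
      · subst hx
        simpa using localMul_mem (mem_localChoices.1 hf.1 x) hu
      · simpa [hx] using mem_localChoices.1 hf.1 x
    · have := pathData_update h f u m (by omega)
      rw [← hm] at this
      rw [this, hf.2]
  · intro f _ f' _ hff'
    funext x
    by_cases hx : x = a
    · subst hx
      have := congrFun hff' x
      simp only [Function.update_self] at this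
      exact localMul_left_injective u this
    · simpa [hx] using congrFun hff' x

lemma map_orbitData_localExt_of_forall_sameCycle (h : ∀ x, σ.SameCycle a x) (ε : α → ℤˣ) :
    (PMF.uniformOfFinset (localChoices ε) (localChoices_nonempty ε)).map
      (fun f => orbitData (localExt σ f) (localLabel f)) = stepMultiset (orbitData σ ε) := by
  rw [orbitData_of_forall_sameCycle a h, ← map_uniform_localSet, ← map_pathData h, PMF.map_comp]
  congr 1
  ext1 f
  exact orbitData_localExt h f

end Transitive

lemma uniform_localChoices_split {α : Type} [Fintype α] (ε : α → ℤˣ) (p : α → Prop)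
    [DecidablePred p] :
    PMF.uniformOfFinset (localChoices ε) (localChoices_nonempty ε) =
      (PMF.uniformOfFinset (localChoices fun x : {x // p x} => ε x)
        (localChoices_nonempty _)).bind fun f =>
        (PMF.uniformOfFinset (localChoices fun x : {x // ¬ p x} => ε x)
          (localChoices_nonempty _)).map fun g x => Sum.elim f g ((Equiv.sumCompl p).symm x) := by
  have key : ∀ (f : {x // p x} → Perm (Fin 3) × (Fin 3 → ℤˣ)) (g : {x // ¬ p x} → _) (y),
      Sum.elim f g ((Equiv.sumCompl p).symm (Equiv.sumCompl p y)) = Sum.elim f g y := fun f g y =>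
    congrArg _ (Equiv.symm_apply_apply _ _)
  refine bind_uniformOfFinset (N := (localChoices fun x : {x // ¬ p x} => ε x).card) _ _
    (fun _ _ => rfl) _ ?_ ?_
  · intro f _ f' _ g _ g' _ h
    refine ⟨funext fun x => ?_, funext fun x => ?_⟩
    · simpa only [key, Sum.elim_inl] using congrFun h (Equiv.sumCompl p (Sum.inl x))
    · simpa only [key, Sum.elim_inr] using congrFun h (Equiv.sumCompl p (Sum.inr x))
  · intro f
    simp only [mem_localChoices]
    constructor
    · intro hf
      refine ⟨fun x => f x, fun x => hf x, fun x => f x, fun x => hf x, funext fun x => ?_⟩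
      obtain ⟨y, rfl⟩ := (Equiv.sumCompl p).surjective x
      rw [key]
      rcases y with y | y <;> rfl
    · rintro ⟨g, hg, g', hg', rfl⟩ x
      obtain ⟨y, rfl⟩ := (Equiv.sumCompl p).surjective x
      change Sum.elim g g' _ ∈ _
      rw [key]
      rcases y with y | y
      · exact hg y
      · exact hg' y

lemma orbitData_split {α : Type} [Fintype α] {σ : Perm α} (p : α → Prop) [DecidablePred p]
    (h : ∀ x, p (σ x) ↔ p x) (ε : α → ℤˣ) :
    orbitData σ ε = orbitData (σ.subtypePerm h) (fun x : {x // p x} => ε x) +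
      orbitData (σ.subtypePerm fun x => not_congr (h x)) (fun x : {x // ¬ p x} => ε x) := by
  rw [← orbitData_equiv (σ := Equiv.sumCongr (σ.subtypePerm h)
    (σ.subtypePerm fun x => not_congr (h x))) (Equiv.sumCompl p), orbitData_sumCongr]
  · rfl
  · rintro (x | x) <;> rfl

lemma orbitData_localExt_split {α : Type} [Fintype α] {σ : Perm α} (p : α → Prop)
    [DecidablePred p] (h : ∀ x, p (σ x) ↔ p x) (f : α → Perm (Fin 3) × (Fin 3 → ℤˣ)) :
    orbitData (localExt σ f) (localLabel f) =
      orbitData (localExt (σ.subtypePerm h) fun x => f x) (localLabel fun x : {x // p x} => f x) +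
      orbitData (localExt (σ.subtypePerm fun x => not_congr (h x)) fun x => f x)
        (localLabel fun x : {x // ¬ p x} => f x) := by
  rw [← orbitData_equiv (σ := Equiv.sumCongr (localExt (σ.subtypePerm h) fun x => f x)
    (localExt (σ.subtypePerm fun x => not_congr (h x)) fun x => f x))
    ((Equiv.sumProdDistrib _ _ _).symm.trans ((Equiv.sumCompl p).prodCongr (Equiv.refl _))),
    orbitData_sumCongr]
  · rfl
  · rintro (x | x) <;> rfl

/-- The cycle data of a uniformly random extension of `σ` compatible with the signs `ε` is
distributed as one step of the Markov process. -/
lemma map_orbitData_localExt (N : ℕ) : ∀ {α : Type} [Fintype α] (_ : Fintype.card α = N)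
    (σ : Perm α) (ε : α → ℤˣ),
    (PMF.uniformOfFinset (localChoices ε) (localChoices_nonempty ε)).map
      (fun f => orbitData (localExt σ f) (localLabel f)) = stepMultiset (orbitData σ ε) := by
  induction N using Nat.strong_induction_on with
  | _ N ih =>
    intro α _ hN σ ε
    classical
    rcases isEmpty_or_nonempty α with hα | ⟨⟨a⟩⟩
    · rw [orbitData_of_isEmpty, stepMultiset_zero,
        ← PMF.map_const (PMF.uniformOfFinset _ (localChoices_nonempty ε))]
      congr 1
      ext1 f
      exact orbitData_of_isEmpty _ _
    -- The cycle of `a` is split off. The choices on it and on its complement are independent, and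
    -- the complement is smaller.
    · have h : ∀ x, σ.SameCycle a (σ x) ↔ σ.SameCycle a x := fun x => Perm.sameCycle_apply_right
      have hlt : Fintype.card {x // ¬ σ.SameCycle a x} < N := by
        rw [← hN]
        exact Fintype.card_subtype_lt (x := a) (by simpa using Perm.SameCycle.refl σ a)
      have h1 := map_orbitData_localExt_of_forall_sameCycle (σ := σ.subtypePerm h)
        (a := ⟨a, Perm.SameCycle.refl σ a⟩) (fun x => Perm.sameCycle_subtypePerm.2 x.2)
        (fun x => ε x)
      have h2 := ih _ hlt rfl (σ.subtypePerm fun x => not_congr (h x)) (fun x => ε x)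
      rw [orbitData_split (fun x => σ.SameCycle a x) h, stepMultiset_add, ← h1, ← h2,
        uniform_localChoices_split ε fun x => σ.SameCycle a x, addDist, PMF.map_bind, PMF.bind_map]
      congr 1
      ext1 f
      rw [Function.comp_apply, PMF.map_comp, PMF.map_comp]
      congr 1
      ext1 g
      rw [Function.comp_apply, orbitData_localExt_split (fun x => σ.SameCycle a x) h]
      have hl : ∀ x : {x // σ.SameCycle a x}, Sum.elim f g ((Equiv.sumCompl _).symm (x : α)) = f x :=
        fun x => by rw [Equiv.sumCompl_symm_apply_pos]; rfl
      have hr : ∀ x : {x // ¬ σ.SameCycle a x}, Sum.elim f g ((Equiv.sumCompl _).symm (x : α)) = g x :=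
        fun x => by rw [Equiv.sumCompl_symm_apply_neg]; rfl
      simp only [hl, hr]
      rfl

/-! ## The distribution of the cycle data in the groups -/

/-- A vertex of level `n + 1` as a vertex of level `n` and a letter. -/
def snocEquiv (n : ℕ) : Word (n + 1) ≃ Word n × Fin 3 where
  toFun v := (Fin.init v, v (Fin.last n))
  invFun p := Fin.snoc (α := fun _ => Fin 3) p.1 p.2
  left_inv v := by simp
  right_inv p := by simp

lemma orbitData_refine {n : ℕ} (g : TypedPerm n) (f : Word n → Perm (Fin 3) × (Fin 3 → ℤˣ)) :
    orbitData (refine g f).1 (refine g f).2 = orbitData (localExt g.1 f) (localLabel f) :=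
  orbitData_equiv (snocEquiv n) (fun v => by
    simp [refine, extend_apply, snocEquiv, localExt]) (localLabel f)

lemma orbitData_refine_zero (g : TypedPerm 0) (p : Perm (Fin 3) × (Fin 3 → ℤˣ)) :
    orbitData (refine g fun _ => p).1 (refine g fun _ => p).2 = orbitData p.1 p.2 := by
  have h : ∀ x, g.1.SameCycle default x := fun x => by
    rw [Subsingleton.elim x default]
  have h1 : pathData g.1 (fun _ : Word 0 => p) default 1 = p := by
    simp [pathData, localMul]
  rw [orbitData_refine, orbitData_localExt h, Fintype.card_unique, h1]
  convert Multiset.map_id _ using 2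
  exact Prod.ext rfl (one_mul _)

lemma refine_fst_inj {n : ℕ} {g g' : TypedPerm n}
    {f f' : Word n → Perm (Fin 3) × (Fin 3 → ℤˣ)} (h : (refine g f).1 = (refine g' f').1) :
    g.1 = g'.1 ∧ ∀ w, (f w).1 = (f' w).1 := by
  replace h : extend (fun w => (f w).1) g.1 = extend (fun w => (f' w).1) g'.1 := h
  exact ⟨(extend_inj.1 h).2, congrFun (extend_inj.1 h).1⟩

lemma refine_inj {n : ℕ} {g g' : TypedPerm n} {f f' : Word n → Perm (Fin 3) × (Fin 3 → ℤˣ)}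
    (h : refine g f = refine g' f') : g.1 = g'.1 ∧ f = f' := by
  obtain ⟨h1, h2⟩ := refine_fst_inj (congrArg Prod.fst h)
  refine ⟨h1, funext fun w => Prod.ext (h2 w) (funext fun j => ?_)⟩
  have := congrFun (congrArg Prod.snd h) (Fin.snoc (α := fun _ => Fin 3) w j)
  simpa [refine] using this

/-- The finite set of typed permutations of level `n + 1` with root data in `P`. -/
def typedFinset (n : ℕ) (P : Finset (Perm (Fin 3) × (Fin 3 → ℤˣ))) : Finset (TypedPerm (n + 1)) :=
  (Set.toFinite (rootedTyped n (P : Set (Perm (Fin 3) × (Fin 3 → ℤˣ))))).toFinset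

lemma mem_typedFinset_zero {P : Finset (Perm (Fin 3) × (Fin 3 → ℤˣ))} {g : TypedPerm 1} :
    g ∈ typedFinset 0 P ↔ ∃ p ∈ P, g = refine (1, fun _ => 1) (fun _ => p) := by
  rw [typedFinset, Set.Finite.mem_toFinset, rootedTyped, typedWreath_typedAut_zero _ 1]
  rfl

lemma mem_typedFinset_succ {n : ℕ} {P : Finset (Perm (Fin 3) × (Fin 3 → ℤˣ))}
    {g : TypedPerm (n + 2)} : g ∈ typedFinset (n + 1) P ↔
      ∃ h ∈ typedFinset n P, ∃ f ∈ localChoices h.2, g = refine h f := by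
  simp only [typedFinset, Set.Finite.mem_toFinset, rootedTyped_succ, mem_localChoices]
  rfl

lemma typedFinset_nonempty {P : Finset (Perm (Fin 3) × (Fin 3 → ℤˣ))} (hP : P.Nonempty) :
    ∀ n, (typedFinset n P).Nonempty
  | 0 => by
    obtain ⟨p, hp⟩ := hP
    exact ⟨_, mem_typedFinset_zero.2 ⟨p, hp, rfl⟩⟩
  | n + 1 => by
    obtain ⟨g, hg⟩ := typedFinset_nonempty hP n
    obtain ⟨f, hf⟩ := localChoices_nonempty g.2
    exact ⟨_, mem_typedFinset_succ.2 ⟨g, hg, f, hf, rfl⟩⟩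

lemma uniform_typedFinset_succ {P : Finset (Perm (Fin 3) × (Fin 3 → ℤˣ))} (hP : P.Nonempty)
    (n : ℕ) : PMF.uniformOfFinset (typedFinset (n + 1) P) (typedFinset_nonempty hP (n + 1)) =
      (PMF.uniformOfFinset (typedFinset n P) (typedFinset_nonempty hP n)).bind fun g =>
        (PMF.uniformOfFinset (localChoices g.2) (localChoices_nonempty _)).map (refine g) := by
  refine bind_uniformOfFinset _ _ (fun _ _ => card_localChoices _) _ ?_ fun _ =>
    mem_typedFinset_succ
  intro g _ g' _ f hf f' hf' h
  -- `refine` discards the labels of `g`, but they are recovered as the signs of the chosen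
  -- permutations, so no two pairs give the same refinement.
  obtain ⟨h1, rfl⟩ := refine_inj h
  refine ⟨Prod.ext h1 (funext fun w => ?_), rfl⟩
  exact (mem_localSet.1 (mem_localChoices.1 hf w)).1.symm.trans
    (mem_localSet.1 (mem_localChoices.1 hf' w)).1

lemma map_orbitData_typedFinset {P : Finset (Perm (Fin 3) × (Fin 3 → ℤˣ))} (hP : P.Nonempty)
    {init : PMF TypeSeq} (h : (PMF.uniformOfFinset P hP).map (fun p => orbitData p.1 p.2) =
      init.map (↑)) (n : ℕ) :
    (PMF.uniformOfFinset (typedFinset n P) (typedFinset_nonempty hP n)).map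
      (fun g => orbitData g.1 g.2) = (markov init n).map (↑) := by
  induction n with
  | zero =>
    rw [markov, ← h, ← map_uniformOfFinset_of_bijOn hP (typedFinset_nonempty hP 0)
      (f := fun p => refine (1, fun _ => 1) (fun _ => p)), PMF.map_comp]
    · congr 1
      ext1 p
      exact orbitData_refine_zero _ p
    · refine ⟨fun p hp => mem_typedFinset_zero.2 ⟨p, hp, rfl⟩, fun p _ q _ h => ?_, fun g hg => ?_⟩
      · exact congrFun (refine_inj h).2 default
      · obtain ⟨p, hp, rfl⟩ := mem_typedFinset_zero.1 hg
        exact ⟨p, hp, rfl⟩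
  | succ n ih =>
    rw [map_coe_markov_succ, ← ih, uniform_typedFinset_succ hP, PMF.map_bind, PMF.bind_map]
    congr 1
    ext1 g
    rw [PMF.map_comp, Function.comp_apply, ← map_orbitData_localExt _ rfl]
    congr 1
    ext1 f
    exact orbitData_refine g f

/-! ### Forgetting the signs of the last level. -/

/-- The root data with permutation in `R`. -/
def rootFinset (R : Finset (Perm (Fin 3))) : Finset (Perm (Fin 3) × (Fin 3 → ℤˣ)) :=
  Finset.univ.filter fun p => p.1 ∈ R ∧ ∏ j, p.2 j = Perm.sign p.1

/-- Both products equal the sign of the local permutation of `σ` at `w`. By the next lemma these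
products are the only constraint on the signs above a given `σ`. -/
lemma prod_eq_of_mem_typedFinset {R : Finset (Perm (Fin 3))} : ∀ {n : ℕ} {σ : Perm (Word (n + 1))}
    {ε ε' : Word (n + 1) → ℤˣ}, (σ, ε) ∈ typedFinset n (rootFinset R) →
    (σ, ε') ∈ typedFinset n (rootFinset R) → ∀ w : Word n,
    ∏ j, ε (Fin.snoc (α := fun _ => Fin 3) w j) = ∏ j, ε' (Fin.snoc (α := fun _ => Fin 3) w j)
  | 0, σ, ε, ε', h, h', w => by
    obtain ⟨p, hp, h⟩ := mem_typedFinset_zero.1 h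
    obtain ⟨p', hp', h'⟩ := mem_typedFinset_zero.1 h'
    have hσ : σ = _ := congrArg Prod.fst h
    have h1 := refine_fst_inj (hσ.symm.trans (congrArg Prod.fst h'))
    obtain rfl : ε = _ := congrArg Prod.snd h
    obtain rfl : ε' = _ := congrArg Prod.snd h'
    have h2 : p.1 = p'.1 := h1.2 w
    simp only [rootFinset, Finset.mem_filter] at hp hp'
    simp only [refine, Fin.snoc_last]
    rw [hp.2.2, hp'.2.2, h2]
  | n + 1, σ, ε, ε', h, h', w => by
    obtain ⟨g, hg, f, hf, h⟩ := mem_typedFinset_succ.1 h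
    obtain ⟨g', hg', f', hf', h'⟩ := mem_typedFinset_succ.1 h'
    have hσ : σ = _ := congrArg Prod.fst h
    have h1 := refine_fst_inj (hσ.symm.trans (congrArg Prod.fst h'))
    obtain rfl : ε = _ := congrArg Prod.snd h
    obtain rfl : ε' = _ := congrArg Prod.snd h'
    have h2 : (f w).1 = (f' w).1 := h1.2 w
    have h3 := mem_localSet.1 (mem_localChoices.1 hf w)
    have h4 := mem_localSet.1 (mem_localChoices.1 hf' w)
    simp only [refine, Fin.init_snoc, Fin.snoc_last]
    rw [h3.2, h4.2, ← h3.1, ← h4.1, h2]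

lemma mem_typedFinset_of_prod_eq {R : Finset (Perm (Fin 3))} : ∀ {n : ℕ} {σ : Perm (Word (n + 1))}
    {ε ε' : Word (n + 1) → ℤˣ}, (σ, ε) ∈ typedFinset n (rootFinset R) → (∀ w : Word n,
    ∏ j, ε' (Fin.snoc (α := fun _ => Fin 3) w j) = ∏ j, ε (Fin.snoc (α := fun _ => Fin 3) w j)) →
    (σ, ε') ∈ typedFinset n (rootFinset R)
  | 0, σ, ε, ε', h, hw => by
    obtain ⟨p, hp, h⟩ := mem_typedFinset_zero.1 h
    obtain rfl : ε = _ := congrArg Prod.snd h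
    obtain rfl : σ = _ := congrArg Prod.fst h
    refine mem_typedFinset_zero.2
      ⟨(p.1, fun j => ε' (Fin.snoc (α := fun _ => Fin 3) default j)), ?_, ?_⟩
    · have := hw default
      simp only [rootFinset, Finset.mem_filter, Finset.mem_univ, true_and] at hp ⊢
      refine ⟨hp.1, this.trans ?_⟩
      simpa only [refine, Fin.snoc_last] using hp.2
    · refine Prod.ext rfl (funext fun v => ?_)
      simp only [refine]
      rw [Subsingleton.elim default (Fin.init v), Fin.snoc_init_self]
  | n + 1, σ, ε, ε', h, hw => by
    obtain ⟨g, hg, f, hf, h⟩ := mem_typedFinset_succ.1 h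
    obtain rfl : ε = _ := congrArg Prod.snd h
    obtain rfl : σ = _ := congrArg Prod.fst h
    refine mem_typedFinset_succ.2 ⟨g, hg,
      fun w => ((f w).1, fun j => ε' (Fin.snoc (α := fun _ => Fin 3) w j)), ?_, ?_⟩
    · refine mem_localChoices.2 fun w => ?_
      have := mem_localSet.1 (mem_localChoices.1 hf w)
      refine mem_localSet.2 ⟨this.1, (hw w).trans ?_⟩
      simpa [refine] using this.2
    · refine Prod.ext rfl (funext fun v => ?_)
      simp [refine]

lemma coe_rootFinset {R : Subgroup (Perm (Fin 3))} {S : Finset (Perm (Fin 3))}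
    (hS : ∀ π, π ∈ S ↔ π ∈ R) : (rootFinset S : Set (Perm (Fin 3) × (Fin 3 → ℤˣ))) = rootData R := by
  ext p
  simp [rootFinset, rootData, hS]

lemma rootFinset_nonempty {S : Finset (Perm (Fin 3))} (hS : 1 ∈ S) : (rootFinset S).Nonempty :=
  ⟨(1, fun _ => 1), by simp [rootFinset, hS]⟩

lemma realizesModel_rootedAut {R : Subgroup (Perm (Fin 3))} {S : Finset (Perm (Fin 3))}
    (hS : ∀ π, π ∈ S ↔ π ∈ R) {init : PMF TypeSeq}
    (h : (PMF.uniformOfFinset (rootFinset S) (rootFinset_nonempty ((hS 1).2 (one_mem R)))).map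
      (fun p => orbitData p.1 p.2) = init.map (↑)) :
    RealizesModel (fun n => rootedAut n R) init := by
  classical
  intro n
  refine ⟨rootedAut_le_treeAut n R, fun c => ?_⟩
  have hP := rootFinset_nonempty ((hS 1).2 (one_mem R))
  have hmem : ∀ σ, σ ∈ rootedAut n R ↔ ∃ ε, (σ, ε) ∈ typedFinset n (rootFinset S) := by
    intro σ
    simp only [mem_rootedAut_iff, typedFinset, Set.Finite.mem_toFinset, coe_rootFinset hS]
  let G : Finset (Perm (Word (n + 1))) := Finset.univ.filter fun σ => σ ∈ rootedAut n R
  have hG : G.Nonempty := ⟨1, by simp [G]⟩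
  have hproj : (PMF.uniformOfFinset _ (typedFinset_nonempty hP n)).map Prod.fst =
      PMF.uniformOfFinset G hG := by
    refine map_uniformOfFinset _ _ ?_ ?_
    · rintro ⟨σ, ε⟩ hσ
      simpa [G] using (hmem σ).2 ⟨ε, hσ⟩
    · intro σ hσ σ' hσ'
      simp only [G, Finset.mem_filter, Finset.mem_univ, true_and, hmem] at hσ hσ'
      obtain ⟨ε, hε⟩ := hσ
      obtain ⟨ε', hε'⟩ := hσ'
      -- The admissible sign families above an automorphism form a torsor under the families with
      -- trivial products below each vertex; multiplication by `ε * ε'` carries one torsor to the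
      -- other.
      refine Finset.card_le_card_of_injOn (fun g => (σ', g.2 * ε * ε')) ?_ ?_
      · rintro ⟨τ, δ⟩ hτ
        rw [Finset.mem_coe, Finset.mem_filter] at hτ ⊢
        obtain ⟨hτ, rfl⟩ := hτ
        refine ⟨mem_typedFinset_of_prod_eq hε' fun w => ?_, rfl⟩
        simp only [Pi.mul_apply, Finset.prod_mul_distrib]
        rw [prod_eq_of_mem_typedFinset hτ hε, Int.units_mul_self, one_mul]
      · rintro ⟨τ, δ⟩ hτ ⟨τ', δ'⟩ hτ' hδ
        rw [Finset.mem_coe, Finset.mem_filter] at hτ hτ'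
        have : δ = δ' := by simpa using congrArg Prod.snd hδ
        exact Prod.ext (hτ.2.trans hτ'.2.symm) this
  have hmap : (PMF.uniformOfFinset G hG).map cycleData = (markov init n).map sizes := by
    have h1 : (markov init n).map sizes = ((markov init n).map
        ((↑) : TypeSeq → Multiset (Label × ℕ))).map (Multiset.map Prod.snd) := by
      rw [PMF.map_comp]
      rfl
    rw [h1, ← map_orbitData_typedFinset hP h n, ← hproj, PMF.map_comp, PMF.map_comp]
    congr 1
    ext1 g
    simp only [Function.comp_apply, map_snd_orbitData, cycleData]
  rw [← hmap, ← PMF.toOuterMeasure_apply_singleton, PMF.toOuterMeasure_map_apply,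
    PMF.toOuterMeasure_uniformOfFinset_apply]
  congr 2
  · rw [Nat.card_eq_fintype_card, Fintype.card_subtype, ← Finset.card_map (Function.Embedding.subtype _)]
    congr 1
    ext σ
    simp [G]
    tauto
  · rw [Nat.card_eq_fintype_card, Fintype.card_subtype]

/-! ### The initial data -/

/-- The index of the labelled cycle data of a root datum in the list `rootTypes`. -/
def rootIndex (p : Perm (Fin 3) × (Fin 3 → ℤˣ)) : Fin 5 :=
  if p.1 = 1 then (if p.2 = fun _ => 1 then 1 else 2)
  else if Perm.sign p.1 = 1 then 0
  else if (transpositionPair p.1 p.2).1 = -1 then 3 else 4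

/-- The possible labelled cycle data at level one. -/
def rootTypes : Fin 5 → TypeSeq :=
  ![[(sq, 3)], [(sq, 1), (sq, 1), (sq, 1)], [(sq, 1), (nsq, 1), (nsq, 1)],
    [(nsq, 2), (sq, 1)], [(sq, 2), (nsq, 1)]]

lemma orbitData_eq_rootTypes {p : Perm (Fin 3) × (Fin 3 → ℤˣ)}
    (hp : ∏ j, p.2 j = Perm.sign p.1) : orbitData p.1 p.2 = rootTypes (rootIndex p) := by
  obtain ⟨π, e⟩ := p
  by_cases h1 : π = 1
  · subst h1
    rw [orbitData_one]
    revert e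
    decide +kernel
  · rcases Int.units_eq_one_or (Perm.sign π) with h | h
    · rw [orbitData_three h h1, hp, h]
      simp [rootIndex, h1, h, rootTypes]
    · rw [orbitData_transposition h]
      clear h1
      revert π e
      decide +kernel

/-- Level one becomes a count of root data by type. `κ` renumbers the five types as entries of the
model; its value at a type that does not occur for `S` is irrelevant. -/
lemma map_orbitData_rootFinset {S : Finset (Perm (Fin 3))} (hS : (rootFinset S).Nonempty) {r : ℕ}
    {w : Fin r → ℝ≥0} (hw : ∑ i, (w i : ℝ≥0∞) = 1) (l : Fin r → TypeSeq) (κ : Fin 5 → Fin r)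
    (hl : ∀ p ∈ rootFinset S, rootTypes (rootIndex p) = l (κ (rootIndex p)))
    {N : ℕ} (hN : (rootFinset S).card = N) (M : Fin r → ℕ)
    (hM : ∀ i, ((rootFinset S).filter fun p => κ (rootIndex p) = i).card = M i)
    (h : ∀ i, w i = M i / N) :
    (PMF.uniformOfFinset (rootFinset S) hS).map (fun p => orbitData p.1 p.2) =
      ((PMF.ofFintype (fun i => (w i : ℝ≥0∞)) hw).map l).map (↑) := by
  rw [← map_uniformOfFinset_eq_ofFintype hS hw fun i => by rw [h, ← hM, ← hN], PMF.map_comp, PMF.map_comp]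
  refine map_uniformOfFinset_congr _ fun p hp => ?_
  rw [orbitData_eq_rootTypes (Finset.mem_filter.1 hp).2.2, hl p hp]
  rfl

lemma realizesModel_groupK : RealizesModel groupK model₁ := by
  rw [show groupK = fun n => rootedAut n ⊥ from _root_.funext groupK_eq]
  refine realizesModel_rootedAut (S := {1}) (by simp [Subgroup.mem_bot]) ?_
  exact map_orbitData_rootFinset _ _ _ ![0, 0, 1, 0, 0] (by decide +kernel)
    (N := 4) (by decide +kernel) ![1, 3] (by decide +kernel)
    (by simp [Fin.forall_fin_succ])

lemma realizesModel_groupL : RealizesModel (fun n => groupL (n + 1)) model₂ := by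
  rw [show (fun n => groupL (n + 1)) = fun n => rootedAut n (alternatingGroup (Fin 3)) from
    _root_.funext groupL_succ]
  refine realizesModel_rootedAut (S := signPerms 1)
    (by simp [signPerms, Perm.mem_alternatingGroup]) ?_
  -- Each of the three even permutations admits four sign triples: two 3-cycles give 8 data, and the
  -- identity gives 1 with all signs trivial and 3 with two signs `-1`.
  exact map_orbitData_rootFinset _ _ _ ![0, 1, 2, 0, 0] (by decide +kernel)
    (N := 12) (by decide +kernel) ![8, 1, 3] (by decide +kernel)
    (by simp [Fin.forall_fin_succ]; norm_num)

lemma mem_pair_iff_mem_zpowers_swap (π : Perm (Fin 3)) :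
    π ∈ ({1, swap 0 1} : Finset (Perm (Fin 3))) ↔ π ∈ Subgroup.zpowers (swap (0 : Fin 3) 1) := by
  rw [Finset.mem_insert, Finset.mem_singleton]
  constructor
  · rintro (rfl | rfl)
    · exact one_mem _
    · exact Subgroup.mem_zpowers _
  · rintro ⟨k, rfl⟩
    have h : (swap (0 : Fin 3) 1) ^ (2 : ℤ) = 1 := by decide
    rcases Int.even_or_odd' k with ⟨m, rfl | rfl⟩
    · exact Or.inl (by simp only [zpow_mul, h, one_zpow])
    · exact Or.inr (by simp only [zpow_add, zpow_mul, h, one_zpow, one_mul, zpow_one])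

lemma realizesModel_groupKY : RealizesModel groupKY model₃ := by
  rw [show groupKY = fun n => rootedAut n (Subgroup.zpowers (swap 0 1)) from
    _root_.funext groupKY_eq]
  refine realizesModel_rootedAut (S := {1, swap 0 1}) mem_pair_iff_mem_zpowers_swap ?_
  exact map_orbitData_rootFinset _ _ _ ![0, 0, 1, 2, 3] (by decide +kernel)
    (N := 8) (by decide +kernel) ![1, 3, 2, 2] (by decide +kernel)
    (by simp [Fin.forall_fin_succ]; norm_num)

lemma realizesModel_groupM : RealizesModel groupM model₄ := by
  rw [show groupM = fun n => rootedAut n ⊤ from _root_.funext groupM_eq]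
  refine realizesModel_rootedAut (S := Finset.univ) (by simp) ?_
  -- The three transpositions add 12 data, divided equally according to which of the two cycles has
  -- label `-1`.
  exact map_orbitData_rootFinset _ _ _ id (by decide +kernel)
    (N := 24) (by decide +kernel) ![8, 1, 3, 6, 6] (by decide +kernel)
    (by simp [Fin.forall_fin_succ]; norm_num)

end CubicMarkov

end

theorem mainTheorem2
    (f : Polynomial CubicMarkov.QSqrtNegThree) (γ₁ γ₂ : ℂ)
    (hf : CubicMarkov.IsPCFCubic f γ₁ γ₂)
    (hcollide : CubicMarkov.CriticalOrbitsDoNotCollide f γ₁ γ₂)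
    (hlength : (CubicMarkov.combinedCriticalOrbit f γ₁ γ₂).ncard = 1)
    (t : CubicMarkov.QSqrtNegThree) :
    (¬ Irreducible (f - Polynomial.C t) → CubicMarkov.CriticalProductIsSquare f γ₁ γ₂ t →
      CubicMarkov.RealizesModel CubicMarkov.groupK CubicMarkov.model₁) ∧
    (Irreducible (f - Polynomial.C t) → CubicMarkov.CriticalProductIsSquare f γ₁ γ₂ t →
      CubicMarkov.RealizesModel (fun n => CubicMarkov.groupL (n + 1)) CubicMarkov.model₂) ∧
    (¬ Irreducible (f - Polynomial.C t) → ¬ CubicMarkov.CriticalProductIsSquare f γ₁ γ₂ t →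
      CubicMarkov.RealizesModel CubicMarkov.groupKY CubicMarkov.model₃) ∧
    (Irreducible (f - Polynomial.C t) → ¬ CubicMarkov.CriticalProductIsSquare f γ₁ γ₂ t →
      CubicMarkov.RealizesModel CubicMarkov.groupM CubicMarkov.model₄) :=
  ⟨fun _ _ => CubicMarkov.realizesModel_groupK, fun _ _ => CubicMarkov.realizesModel_groupL,
    fun _ _ => CubicMarkov.realizesModel_groupKY, fun _ _ => CubicMarkov.realizesModel_groupM⟩
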